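/- Let $r$ and $a$ be integers with $0<a<r$ and $\gcd(r,a)=1$, let $\varepsilon=e^{2\pi i/r}$, and let $G=\tfrac1r(1,a,r-a)$ be the cyclic group of order $r$ generated by $\mathrm{diag}(\varepsilon,\varepsilon^{a},\varepsilon^{r-a})$, acting on $\mathbb C^3$. For a monomial $X^u=x^{u_1}y^{u_2}z^{u_3}$ let $\mathrm{wt}(X^u)$ be the character $\chi$ of $G$ with $X^u(g\cdot p)=\chi(g)X^u(p)$ for all $g\in G$, $p\in\mathbb C^3$. A $G$-graph is a set $\Gamma$ of monomials that consists of all monomials outside some monomial ideal of $\mathbb C[x,y,z]$ and on which $\mathrm{wt}$ restricts to a bijection onto the character group of $G$. For a monomial $X^u$, let $\mathrm{wt}_\Gamma(X^u)$ be the unique monomial in $\Gamma$ with the same character as $X^u$, and let $A_\Gamma$ be the set of minimal monomial generators of the ideal generated by the monomials not in $\Gamma$. Put $$\sigma(\Gamma)=\{w\in\mathbb R^3 \mid w\cdot X^u> w\cdot \mathrm{wt}_\Gamma(X^u)\ \text{for all } X^u\in A_\Gamma\},$$ where $w\cdot X^u$ is the standard inner product of $w$ and $u$. Let $\mathrm{Fan}(G)$,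 the fan of $G\text{-}\mathrm{Hilb}(\mathbb C^3)$, consist of the closures of all three-dimensional cones $\sigma(\Gamma)$, $\Gamma$ a $G$-graph, together with all their faces. Let $S$ be the slice of $\mathrm{Fan}(G)$ at height $r$, i.e. the polyhedral complex formed by the intersections of its cones with the plane through $r\boldsymbol e_1$, $r\boldsymbol e_2$, $r\boldsymbol e_3$; its vertices and edges are the slices of the one- and two-dimensional cones of $\mathrm{Fan}(G)$. Then every vertex of $S$ other than $r\boldsymbol e_1,r\boldsymbol e_2,r\boldsymbol e_3$ has degree (the number of edges of $S$ containing it) at least $3$ and at most $5$. -/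

import Mathlib

namespace GHilb

noncomputable section

open MvPolynomial

/-- The diagonal matrix `diag(ε, ε ^ a, ε ^ (r - a))` with `ε = exp (2πi / r)`, written as an element
of the group of invertible diagonal `3 × 3` matrices. -/
def generator (r a : ℕ) : Fin 3 → ℂˣ :=
  let ε : ℂˣ := Units.mk0 (Complex.exp (2 * Real.pi * Complex.I / r)) (Complex.exp_ne_zero _)
  ![ε, ε ^ a, ε ^ (r - a)]

/-- The cyclic group `G = 1/r(1, a, r - a)` of diagonal matrices. -/
def group (r a : ℕ) : Subgroup (Fin 3 → ℂˣ) :=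
  Subgroup.zpowers (generator r a)

/-- The character `wt(X ^ u)` of `G` attached to the monomial `X ^ u = x ^ u₀ y ^ u₁ z ^ u₂`; the
lemma `eval_smul_monomial` below is its defining property `X ^ u (g p) = wt(X ^ u)(g) X ^ u (p)`. -/
def wt (r a : ℕ) (u : Fin 3 →₀ ℕ) : group r a →* ℂˣ where
  toFun g := ∏ i, (g : Fin 3 → ℂˣ) i ^ u i
  map_one' := by simp
  map_mul' g h := by simp [mul_pow, Finset.prod_mul_distrib]

theorem eval_smul_monomial (r a : ℕ) (u : Fin 3 →₀ ℕ) (g : group r a) (p : Fin 3 → ℂ) :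
    eval (fun i => ((g : Fin 3 → ℂˣ) i : ℂ) * p i) (monomial u (1 : ℂ)) =
      (wt r a u g : ℂ) * eval p (monomial u (1 : ℂ)) := by
  simp [wt, eval_monomial, Finsupp.prod_fintype, mul_pow, Finset.prod_mul_distrib]

/-- Ideals of `ℂ[x, y, z]` generated by monomials. -/
def IsMonomialIdeal (I : Ideal (MvPolynomial (Fin 3) ℂ)) : Prop :=
  ∃ s : Set (Fin 3 →₀ ℕ), I = Ideal.span ((fun u => monomial u (1 : ℂ)) '' s)

/-- A `G`-graph, as a set of exponents: the monomials outside a monomial ideal, such that `wt`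
restricts to a bijection from them onto the character group of `G`. -/
def IsGGraph (r a : ℕ) (Γ : Set (Fin 3 →₀ ℕ)) : Prop :=
  (∃ I : Ideal (MvPolynomial (Fin 3) ℂ),
    IsMonomialIdeal I ∧ Γ = {u | monomial u (1 : ℂ) ∉ I}) ∧
  Set.BijOn (wt r a) Γ Set.univ

/-- The minimal generators `A_Γ` of the monomial ideal spanned by the monomials outside `Γ`
(the order on exponents is divisibility of monomials). -/
def minGens (Γ : Set (Fin 3 →₀ ℕ)) : Set (Fin 3 →₀ ℕ) :=
  {u | Minimal (fun u' => u' ∉ Γ) u}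

/-- The standard inner product `w · X ^ u`. -/
def pairing (w : Fin 3 → ℝ) (u : Fin 3 →₀ ℕ) : ℝ :=
  ∑ i, w i * (u i : ℝ)

/-- The open cone `σ(Γ)`: all `w` with `w · X ^ u > w · wt_Γ(X ^ u)` for every `u ∈ A_Γ`, where
`wt_Γ(X ^ u)` is the monomial in `Γ` that has the same character as `X ^ u`. -/
def openCone (r a : ℕ) (Γ : Set (Fin 3 →₀ ℕ)) : Set (Fin 3 → ℝ) :=
  {w | ∀ u ∈ minGens Γ, ∀ u' ∈ Γ, wt r a u' = wt r a u → pairing w u' < pairing w u}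

/-- The closed cone, given by the corresponding weak inequalities; it is the closure of the open
cone whenever the latter is non-empty. -/
def closedCone (r a : ℕ) (Γ : Set (Fin 3 →₀ ℕ)) : Set (Fin 3 → ℝ) :=
  {w | ∀ u ∈ minGens Γ, ∀ u' ∈ Γ, wt r a u' = wt r a u → pairing w u' ≤ pairing w u}

/-- `τ` is a face of the cone `σ` (possibly `σ` itself): the zero locus in `σ` of a linear form that
is non-negative on `σ`. -/
def IsFace (τ σ : Set (Fin 3 → ℝ)) : Prop :=
  ∃ m : Fin 3 → ℝ, (∀ w ∈ σ, 0 ≤ ∑ i, m i * w i) ∧ τ = {w ∈ σ | ∑ i, m i * w i = 0}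

/-- `Fan(G)`, the fan of `G`-Hilb: all three-dimensional closed cones of `G`-graphs and their faces.
(The cone is three-dimensional exactly if the open cone is non-empty.) -/
def fan (r a : ℕ) : Set (Set (Fin 3 → ℝ)) :=
  {τ | ∃ Γ, IsGGraph r a Γ ∧ (openCone r a Γ).Nonempty ∧ IsFace τ (closedCone r a Γ)}

/-- The slice of the fan at height `r`: the polyhedral complex of the intersections of its cones
with the plane through `r e₁`, `r e₂` and `r e₃`. -/
def slice (r a : ℕ) : Set (Set (Fin 3 → ℝ)) :=
  {P | ∃ τ ∈ fan r a, P = τ ∩ {w | ∑ i, w i = (r : ℝ)}}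

/-- `v` is a vertex of the slice: the slice of a one-dimensional cone. -/
def IsVertex (r a : ℕ) (v : Fin 3 → ℝ) : Prop :=
  {v} ∈ slice r a

/-- `E` is an edge of the slice: the slice of a two-dimensional cone. -/
def IsEdge (r a : ℕ) (E : Set (Fin 3 → ℝ)) : Prop :=
  E ∈ slice r a ∧ ∃ p q : Fin 3 → ℝ, p ≠ q ∧ E = segment ℝ p q

/-- The degree (valency) of `v`: the number of edges of the slice that contain `v`. -/
def degree (r a : ℕ) (v : Fin 3 → ℝ) : ℕ∞ :=
  {E | IsEdge r a E ∧ v ∈ E}.encard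

end

end GHilb

namespace GHilb

open MvPolynomial Filter Topology

/-! For a weight vector `w`, let `minimizers r a w` be the monomials of least `w`-weight among those
of the same character. A full-dimensional closed cone of a `G`-graph `Γ` is the set of `w` with `Γ ⊆
minimizers r a w` (`IsGGraph.mem_closedCone_iff`), so the fan is governed by ties: pairs of distinct
least-weight monomials with equal character. A vertex is pinned down by its ties
(`IsVertex.eq_zero_of_ties`), relative interior points of an edge carry a tie that is also a tie at
its ends, and a vertex that is not a corner has positive coordinates (`IsVertex.pos`).

Upper bound: `yz` is invariant, so at a positive `w` no least-weight monomial is divisible by `yz`.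
After cancelling common factors, a tie along an edge reads `x^i y^j ~ z^k`, or `x^n ~ y^j`, up to
swapping `y` and `z`. The shape, the choice of variable and the side of `v` give eight labels. A
label determines the edge (`HasLabel.exists_pos_smul`), and exchanging factors between ties rules
out certain pairs of labels (`HasLabel.not_inner_of_axis`, `HasLabel.not_axes`), which leaves at
most five.

Lower bound: every nonzero direction breaks some tie at `v`. Turning one direction towards another
therefore meets a direction in which two monomials become tied for least weight, and this produces
an edge (`IsVertex.exists_isEdge`). Hence there is one edge, and there is a further one strictly on
each side of its line. -/

theorem wt_add (r a : ℕ) (u u' : Fin 3 →₀ ℕ) : wt r a (u + u') = wt r a u * wt r a u' := by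
  ext g; simp [wt, pow_add, Finset.prod_mul_distrib]

theorem wt_add_right_cancel {r a : ℕ} {u u' c : Fin 3 →₀ ℕ} :
    wt r a (u + c) = wt r a (u' + c) ↔ wt r a u = wt r a u' := by
  rw [wt_add, wt_add, mul_left_inj]

theorem pairing_add_right (w : Fin 3 → ℝ) (u u' : Fin 3 →₀ ℕ) :
    pairing w (u + u') = pairing w u + pairing w u' := by
  simp [pairing, mul_add, Finset.sum_add_distrib]

theorem pairing_add_left (w w' : Fin 3 → ℝ) (u : Fin 3 →₀ ℕ) :
    pairing (w + w') u = pairing w u + pairing w' u := by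
  simp [pairing, add_mul, Finset.sum_add_distrib]

theorem pairing_smul_left (c : ℝ) (w : Fin 3 → ℝ) (u : Fin 3 →₀ ℕ) :
    pairing (c • w) u = c * pairing w u := by
  simp [pairing, mul_assoc, Finset.mul_sum]

theorem pairing_sub_left (w w' : Fin 3 → ℝ) (u : Fin 3 →₀ ℕ) :
    pairing (w - w') u = pairing w u - pairing w' u := by
  simp [pairing, sub_mul, Finset.sum_sub_distrib]

theorem pairing_neg_left (w : Fin 3 → ℝ) (u : Fin 3 →₀ ℕ) :
    pairing (-w) u = -pairing w u := by
  simp [pairing]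

theorem pairing_zero_right (w : Fin 3 → ℝ) : pairing w 0 = 0 := by
  simp [pairing]

theorem pairing_single (w : Fin 3 → ℝ) (i : Fin 3) (n : ℕ) :
    pairing w (Finsupp.single i n) = w i * n := by
  rw [pairing, Finset.sum_eq_single i] <;> simp +contextual [eq_comm]

/-! ### Characters of the group as residues modulo `r`. -/

/-- The exponent of `ε` in the value of `wt r a u` at the generator. -/
def weight (r a : ℕ) (u : Fin 3 →₀ ℕ) : ℕ :=
  u 0 + a * u 1 + (r - a) * u 2

/-- The generator as an element of the group. -/
noncomputable def gen (r a : ℕ) : group r a :=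
  ⟨generator r a, Subgroup.mem_zpowers _⟩

theorem hom_ext_gen {r a : ℕ} {χ ψ : group r a →* ℂˣ} (h : χ (gen r a) = ψ (gen r a)) :
    χ = ψ := by
  ext1 ⟨g, hg⟩
  obtain ⟨k, rfl⟩ := Subgroup.mem_zpowers_iff.1 hg
  have : (⟨generator r a ^ k, hg⟩ : group r a) = gen r a ^ k := by
    ext1; simp [gen]
  rw [this, map_zpow, map_zpow, h]

/-- The root of unity `exp (2πi / r)`. -/
noncomputable def root (r : ℕ) : ℂˣ :=
  Units.mk0 (Complex.exp (2 * Real.pi * Complex.I / r)) (Complex.exp_ne_zero _)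

theorem wt_gen (r a : ℕ) (u : Fin 3 →₀ ℕ) : wt r a u (gen r a) = root r ^ weight r a u := by
  simp [wt, gen, generator, root, weight, Fin.prod_univ_three, pow_add, pow_mul]

theorem isPrimitiveRoot_root {r : ℕ} (hr : r ≠ 0) : IsPrimitiveRoot (root r) r := by
  rw [← IsPrimitiveRoot.coe_units_iff]
  exact Complex.isPrimitiveRoot_exp r hr

theorem wt_eq_iff {r a : ℕ} (hr : r ≠ 0) {u u' : Fin 3 →₀ ℕ} :
    wt r a u = wt r a u' ↔ weight r a u ≡ weight r a u' [MOD r] := by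
  have h : wt r a u = wt r a u' ↔ wt r a u (gen r a) = wt r a u' (gen r a) :=
    ⟨fun h => by rw [h], hom_ext_gen⟩
  rw [h, wt_gen, wt_gen, pow_eq_pow_iff_modEq, ← (isPrimitiveRoot_root hr).eq_orderOf]

theorem exists_wt_single_zero {r a : ℕ} (hr : r ≠ 0) (χ : group r a →* ℂˣ) :
    ∃ k < r, wt r a (Finsupp.single 0 k) = χ := by
  have h1 : gen r a ^ r = 1 := by
    have h := (isPrimitiveRoot_root hr).pow_eq_one
    ext i : 2
    have : ((gen r a ^ r : group r a) : Fin 3 → ℂˣ) i = generator r a i ^ r := by simp [gen]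
    rw [this]
    fin_cases i
    · exact h
    · change (root r ^ a) ^ r = 1
      rw [pow_right_comm, h, one_pow]
    · change (root r ^ (r - a)) ^ r = 1
      rw [pow_right_comm, h, one_pow]
  have h2 : (χ (gen r a) : ℂ) ^ r = 1 := by
    have : χ (gen r a) ^ r = 1 := by rw [← map_pow, h1, map_one]
    rw [← Units.val_pow_eq_pow_val, this, Units.val_one]
  have : NeZero r := ⟨hr⟩
  obtain ⟨k, hk, hk'⟩ :=
    (IsPrimitiveRoot.coe_units_iff.2 (isPrimitiveRoot_root hr)).eq_pow_of_pow_eq_one h2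
  refine ⟨k, hk, hom_ext_gen ?_⟩
  rw [wt_gen]
  ext1
  simpa [weight] using hk'

/-- Coprimality makes each of the weights `1`, `a`, `r - a` a unit modulo `r`. -/
theorem exists_wt_single {r a : ℕ} (ha : 0 < a) (har : a < r) (hra : Nat.Coprime r a)
    (i : Fin 3) (u : Fin 3 →₀ ℕ) : ∃ k, wt r a (Finsupp.single i k) = wt r a u := by
  have hr : r ≠ 0 := by omega
  have hc : ∃ c, Nat.Coprime c r ∧ ∀ k, weight r a (Finsupp.single i k) = c * k := by
    fin_cases i
    · exact ⟨1, by simp, fun k => by simp [weight]⟩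
    · exact ⟨a, hra.symm, fun k => by simp [weight]⟩
    · exact ⟨r - a, (Nat.coprime_self_sub_left har.le).2 hra.symm, fun k => by simp [weight]⟩
  obtain ⟨c, hc, hw⟩ := hc
  obtain ⟨m, -, hm⟩ := Nat.exists_mul_mod_eq_one_of_coprime hc (by omega)
  refine ⟨m * weight r a u, (wt_eq_iff hr).2 ?_⟩
  have h1 : c * m ≡ 1 [MOD r] := by
    rw [Nat.ModEq, hm, Nat.mod_eq_of_lt (by omega)]
  rw [hw, ← mul_assoc]
  simpa using h1.mul_right (weight r a u)

theorem wt_single_self {r a : ℕ} (har : a < r) (i : Fin 3) :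
    wt r a (Finsupp.single i r) = wt r a 0 := by
  rw [wt_eq_iff (by omega)]
  fin_cases i <;> simp [weight, Nat.ModEq]

theorem wt_yz {r a : ℕ} (har : a < r) :
    wt r a (Finsupp.single 1 1 + Finsupp.single 2 1) = wt r a 0 := by
  rw [wt_eq_iff (by omega)]
  simp [weight, Nat.ModEq, Nat.add_sub_cancel' har.le]

/-! ### Monomials of least weight. -/

/-- The monomials of least `w`-weight among those with the same character. -/
def minimizers (r a : ℕ) (w : Fin 3 → ℝ) : Set (Fin 3 →₀ ℕ) :=
  {u | ∀ u', wt r a u' = wt r a u → pairing w u ≤ pairing w u'}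

theorem pairing_nonneg {w : Fin 3 → ℝ} (hw : ∀ i, 0 ≤ w i) (u : Fin 3 →₀ ℕ) :
    0 ≤ pairing w u :=
  Finset.sum_nonneg fun i _ => mul_nonneg (hw i) (Nat.cast_nonneg _)

theorem le_pairing {w : Fin 3 → ℝ} (hw : ∀ i, 0 ≤ w i) (u : Fin 3 →₀ ℕ) (i : Fin 3) :
    w i * u i ≤ pairing w u :=
  Finset.single_le_sum (f := fun i => w i * (u i : ℝ))
    (fun i _ => mul_nonneg (hw i) (Nat.cast_nonneg _)) (Finset.mem_univ i)

theorem pairing_pos {w : Fin 3 → ℝ} (hw : ∀ i, 0 < w i) {u : Fin 3 →₀ ℕ} (hu : u ≠ 0) :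
    0 < pairing w u := by
  obtain ⟨i, hi⟩ := Finsupp.ne_iff.1 hu
  have h : 0 < w i * u i := mul_pos (hw i) (by exact_mod_cast Nat.pos_of_ne_zero hi)
  exact h.trans_le (le_pairing (fun i => (hw i).le) u i)

theorem finite_pairing_le {w : Fin 3 → ℝ} (hw : ∀ i, 0 < w i) (R : ℝ) :
    {u : Fin 3 →₀ ℕ | pairing w u ≤ R}.Finite := by
  refine (Set.finite_Iic (Finsupp.equivFunOnFinite.symm fun i => ⌊R / w i⌋₊)).subset ?_
  intro u hu i
  refine Nat.le_floor (α := ℝ) (a := R / w i) ?_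
  rw [le_div_iff₀ (hw i), mul_comm]
  exact (le_pairing (fun i => (hw i).le) u i).trans hu

theorem exists_minimizer {r a : ℕ} {w : Fin 3 → ℝ} (hw : ∀ i, 0 < w i) (u : Fin 3 →₀ ℕ) :
    ∃ u' ∈ minimizers r a w, wt r a u' = wt r a u := by
  obtain ⟨u', ⟨h1, h2⟩, h3⟩ := Set.exists_min_image
    {u' | pairing w u' ≤ pairing w u ∧ wt r a u' = wt r a u} (pairing w)
    ((finite_pairing_le hw _).subset fun _ h => h.1) ⟨u, le_rfl, rfl⟩
  refine ⟨u', fun u'' h => ?_, h2⟩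
  rcases le_total (pairing w u'') (pairing w u) with h4 | h4
  · exact h3 u'' ⟨h4, h.trans h2⟩
  · exact h1.trans h4

theorem pairing_le_of_mem_minimizers {r a : ℕ} (hr : r ≠ 0) {w : Fin 3 → ℝ} (hw : ∀ i, 0 ≤ w i)
    {u : Fin 3 →₀ ℕ} (hu : u ∈ minimizers r a w) : pairing w u ≤ w 0 * r := by
  obtain ⟨k, hk, hk'⟩ := exists_wt_single_zero hr (wt r a u)
  refine (hu _ hk').trans ?_
  rw [pairing_single]
  exact mul_le_mul_of_nonneg_left (by exact_mod_cast hk.le) (hw 0)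

theorem finite_minimizers {r a : ℕ} (hr : r ≠ 0) {w : Fin 3 → ℝ} (hw : ∀ i, 0 < w i) :
    (minimizers r a w).Finite :=
  (finite_pairing_le hw _).subset fun _ => pairing_le_of_mem_minimizers hr fun i => (hw i).le

section Minimizers

variable {r a : ℕ} {w : Fin 3 → ℝ} {u u' c : Fin 3 →₀ ℕ}

theorem pairing_eq_of_mem_minimizers (hu : u ∈ minimizers r a w) (hu' : u' ∈ minimizers r a w)
    (h : wt r a u = wt r a u') : pairing w u = pairing w u' :=
  le_antisymm (hu _ h.symm) (hu' _ h)

theorem mem_minimizers_of_pairing_le (hu : u ∈ minimizers r a w) (h : wt r a u' = wt r a u)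
    (hp : pairing w u' ≤ pairing w u) : u' ∈ minimizers r a w :=
  fun u'' h' => hp.trans (hu u'' (h'.trans h))

/-- A cheaper substitute for a divisor, times the cofactor, would be a cheaper substitute for the
product. -/
theorem mem_minimizers_of_add (hu : u + c ∈ minimizers r a w) : u ∈ minimizers r a w := by
  intro u' h
  have := hu (u' + c) (wt_add_right_cancel.2 h)
  rw [pairing_add_right, pairing_add_right] at this
  linarith

theorem add_mem_minimizers (hu : u + c ∈ minimizers r a w) (hu' : u' ∈ minimizers r a w)
    (h : wt r a u' = wt r a u) : u' + c ∈ minimizers r a w := by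
  refine mem_minimizers_of_pairing_le hu (wt_add_right_cancel.2 h) ?_
  rw [pairing_add_right, pairing_add_right]
  linarith [hu' u h.symm]

end Minimizers

/-! ### First-order perturbation of finitely many inequalities. -/

theorem eventually_add_mul_pos {ι : Type*} {S : Set ι} (hS : S.Finite) (f g : ι → ℝ)
    (hf : ∀ x ∈ S, 0 < f x ∨ f x = 0 ∧ 0 < g x) :
    ∀ᶠ s in 𝓝[>] (0 : ℝ), ∀ x ∈ S, 0 < f x + s * g x := by
  refine (hS.eventually_all).2 fun x hx => ?_
  rcases hf x hx with h | ⟨h, h'⟩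
  · have : Tendsto (fun s : ℝ => f x + s * g x) (𝓝[>] 0) (𝓝 (f x + 0 * g x)) :=
      (Continuous.tendsto (by fun_prop) 0).mono_left nhdsWithin_le_nhds
    exact this.eventually_const_lt (by simpa using h)
  · filter_upwards [self_mem_nhdsWithin] with s hs
    rw [h, zero_add]
    exact mul_pos hs h'

theorem eventually_add_mul_nonneg {ι : Type*} {S : Set ι} (hS : S.Finite) (f g : ι → ℝ)
    (hf : ∀ x ∈ S, 0 < f x ∨ f x = 0 ∧ 0 ≤ g x) :
    ∀ᶠ s in 𝓝[>] (0 : ℝ), ∀ x ∈ S, 0 ≤ f x + s * g x := by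
  refine (hS.eventually_all).2 fun x hx => ?_
  rcases hf x hx with h | ⟨h, h'⟩
  · filter_upwards [eventually_add_mul_pos (Set.finite_singleton x) f g
      (by simpa using Or.inl h)] with s hs
    exact (hs x rfl).le
  · filter_upwards [self_mem_nhdsWithin] with s hs
    rw [h, zero_add]
    exact mul_nonneg (le_of_lt hs) h'

/-! ### `G`-graphs and positivity of their open cones. -/

theorem IsGGraph.mem_of_le {r a : ℕ} {Γ : Set (Fin 3 →₀ ℕ)} (hΓ : IsGGraph r a Γ)
    {u u' : Fin 3 →₀ ℕ} (h : u ≤ u') (hu' : u' ∈ Γ) : u ∈ Γ := by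
  obtain ⟨⟨I, -, rfl⟩, -⟩ := hΓ
  intro hu
  apply hu'
  have : monomial u' (1 : ℂ) = monomial (u' - u) 1 * monomial u 1 := by
    rw [monomial_mul, tsub_add_cancel_of_le h, one_mul]
  rw [this]
  exact I.mul_mem_left _ hu

theorem IsGGraph.exists_rep {r a : ℕ} {Γ : Set (Fin 3 →₀ ℕ)} (hΓ : IsGGraph r a Γ)
    (u : Fin 3 →₀ ℕ) : ∃ u' ∈ Γ, wt r a u' = wt r a u :=
  hΓ.2.surjOn (Set.mem_univ _)

theorem IsGGraph.eq_of_wt_eq {r a : ℕ} {Γ : Set (Fin 3 →₀ ℕ)} (hΓ : IsGGraph r a Γ)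
    {u u' : Fin 3 →₀ ℕ} (hu : u ∈ Γ) (hu' : u' ∈ Γ) (h : wt r a u = wt r a u') : u = u' :=
  hΓ.2.injOn hu hu' h

theorem IsGGraph.zero_mem {r a : ℕ} {Γ : Set (Fin 3 →₀ ℕ)} (hΓ : IsGGraph r a Γ) :
    (0 : Fin 3 →₀ ℕ) ∈ Γ := by
  obtain ⟨u, hu, -⟩ := hΓ.exists_rep 0
  exact hΓ.mem_of_le (zero_le (a := u)) hu

/-- Dickson's lemma: antichains of exponents are finite. -/
theorem finite_minGens (Γ : Set (Fin 3 →₀ ℕ)) : (minGens Γ).Finite := by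
  have h : IsAntichain (· ≤ ·) (minGens Γ) := setOfPred_minimal_antichain _
  have hp : (minGens Γ).IsPWO := Set.isPWO_of_wellQuasiOrderedLE _
  exact h.finite_of_partiallyWellOrderedOn hp

theorem exists_minGens_le {Γ : Set (Fin 3 →₀ ℕ)} {u : Fin 3 →₀ ℕ} (hu : u ∉ Γ) :
    ∃ g ∈ minGens Γ, g ≤ u := by
  obtain ⟨g, hg, hg'⟩ := exists_minimal_le_of_wellFoundedLT (fun u' => u' ∉ Γ) u hu
  exact ⟨g, hg', hg⟩

/-- A monomial outside `Γ` has a minimal generator as divisor, and on the open cone that generator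
is strictly beaten by its representative. -/
theorem IsGGraph.minimizers_subset {r a : ℕ} {Γ : Set (Fin 3 →₀ ℕ)} (hΓ : IsGGraph r a Γ)
    {w : Fin 3 → ℝ} (hw : w ∈ openCone r a Γ) : minimizers r a w ⊆ Γ := by
  intro u hu
  by_contra hn
  obtain ⟨g, hg, hgu⟩ := exists_minGens_le hn
  obtain ⟨g', hg', h⟩ := hΓ.exists_rep g
  have h1 := hw g hg g' hg' h
  have h2 : g + (u - g) ∈ minimizers r a w := by rwa [add_tsub_cancel_of_le hgu]
  exact absurd (mem_minimizers_of_add h2 g' h) (not_le.2 h1)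

theorem IsGGraph.single_notMem {r a : ℕ} (har : a < r) {Γ : Set (Fin 3 →₀ ℕ)}
    (hΓ : IsGGraph r a Γ) (i : Fin 3) : Finsupp.single i r ∉ Γ := by
  intro h
  have := hΓ.eq_of_wt_eq h hΓ.zero_mem (wt_single_self har i)
  rw [Finsupp.single_eq_zero] at this
  omega

theorem IsGGraph.yz_notMem {r a : ℕ} (har : a < r) {Γ : Set (Fin 3 →₀ ℕ)}
    (hΓ : IsGGraph r a Γ) : Finsupp.single 1 1 + Finsupp.single 2 1 ∉ Γ := by
  intro h
  have := DFunLike.congr_fun (hΓ.eq_of_wt_eq h hΓ.zero_mem (wt_yz har)) 1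
  simp at this

theorem le_yz_iff {u : Fin 3 →₀ ℕ} :
    Finsupp.single 1 1 + Finsupp.single 2 1 ≤ u ↔ 0 < u 1 ∧ 0 < u 2 := by
  rw [Finsupp.le_def]
  simp [Fin.forall_fin_succ, Nat.one_le_iff_ne_zero, Nat.pos_iff_ne_zero]

/-- For each variable there is a least power outside `Γ`; it is a minimal generator, its
representative in `Γ` avoids that variable, and it bounds the exponents occurring in `Γ`. -/
theorem IsGGraph.exists_power {r a : ℕ} (har : a < r) {Γ : Set (Fin 3 →₀ ℕ)}
    (hΓ : IsGGraph r a Γ) (i : Fin 3) :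
    ∃ n, 0 < n ∧ Finsupp.single i n ∈ minGens Γ ∧ (∀ u ∈ Γ, u i < n) ∧
      ∃ u ∈ Γ, wt r a u = wt r a (Finsupp.single i n) ∧ u i = 0 := by
  classical
  have hex : ∃ n, Finsupp.single i n ∉ Γ := ⟨r, hΓ.single_notMem har i⟩
  obtain ⟨n, hn, hmin⟩ : ∃ n, Finsupp.single i n ∉ Γ ∧ ∀ k < n, Finsupp.single i k ∈ Γ :=
    ⟨Nat.find hex, Nat.find_spec hex, fun k hk => not_not.1 (Nat.find_min hex hk)⟩
  have hpos : 0 < n := by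
    rcases Nat.eq_zero_or_pos n with h | h
    · rw [h, Finsupp.single_zero] at hn
      exact absurd hΓ.zero_mem hn
    · exact h
  refine ⟨n, hpos, ⟨hn, fun u hu hle => ?_⟩, fun u hu => ?_, ?_⟩
  · have h1 : u = Finsupp.single i (u i) := by
      ext j
      rcases eq_or_ne j i with rfl | hj
      · simp
      · have := hle j
        rw [Finsupp.single_eq_of_ne hj] at this ⊢
        omega
    by_contra hlt
    have h2 : u i ≤ n := by simpa using hle i
    rcases h2.lt_or_eq with h3 | h3
    · have h4 := hmin _ h3
      rw [← h1] at h4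
      exact hu h4
    · rw [h1, h3] at hlt
      exact hlt le_rfl
  · by_contra hle
    exact hn (hΓ.mem_of_le (Finsupp.single_le_iff.2 (not_lt.1 hle)) hu)
  · obtain ⟨u, hu, hwt⟩ := hΓ.exists_rep (Finsupp.single i n)
    refine ⟨u, hu, hwt, ?_⟩
    by_contra h0
    -- If the representative contained the variable, cancelling it once on both sides would give two
    -- monomials of `Γ` with equal character, hence equal ones, and the power itself would lie in
    -- `Γ`.
    have h1 : u = u - Finsupp.single i 1 + Finsupp.single i 1 :=
      (tsub_add_cancel_of_le (Finsupp.single_le_iff.2 (Nat.pos_of_ne_zero h0))).symm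
    have h2 : Finsupp.single i n = Finsupp.single i (n - 1) + Finsupp.single i 1 := by
      rw [← Finsupp.single_add, Nat.sub_add_cancel hpos]
    rw [h1, h2, wt_add_right_cancel] at hwt
    have h3 := hΓ.eq_of_wt_eq (hΓ.mem_of_le tsub_le_self hu) (hmin (n - 1) (by omega)) hwt
    rw [h3, ← h2] at h1
    exact hn (h1 ▸ hu)

/-- If `α ≤ 0`, the first inequality forces `β < 0`; chaining the two gives `i * b * β < n * m * β`,
against `i * b ≤ n * m`. -/
theorem pos_of_mul_lt {n m b i : ℕ} {α β : ℝ} (hb : b < m) (hi : i < n) (h1 : b * β < n * α)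
    (h2 : i * α < m * β) : 0 < α ∧ 0 < β := by
  have hb' : (b : ℝ) + 1 ≤ m := by exact_mod_cast hb
  have hi' : (i : ℝ) + 1 ≤ n := by exact_mod_cast hi
  have hb0 : (0 : ℝ) ≤ b := b.cast_nonneg
  have hi0 : (0 : ℝ) ≤ i := i.cast_nonneg
  have hα : 0 < α := by
    by_contra hα
    have hα := not_lt.1 hα
    have h3 : b * β < 0 := h1.trans_le (mul_nonpos_of_nonneg_of_nonpos (by linarith) hα)
    have hβ : β < 0 := by
      by_contra hβ
      exact absurd h3 (not_lt.2 (mul_nonneg hb0 (not_lt.1 hβ)))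
    have h4 : (i : ℝ) * (b * β) ≤ i * (n * α) := mul_le_mul_of_nonneg_left h1.le hi0
    have h5 : n * (i * α) < n * (m * β) := mul_lt_mul_of_pos_left h2 (by linarith)
    have h6 : (i : ℝ) * b ≤ n * m := mul_le_mul (by linarith) (by linarith) hb0 (by linarith)
    nlinarith
  refine ⟨hα, ?_⟩
  have : 0 < m * β := (mul_nonneg hi0 hα.le).trans_lt h2
  exact pos_of_mul_pos_right this (by linarith)

/-- Each least pure power outside `Γ` is compared with its representative, which avoids that
variable. The representative of the power of `x` is a pure power of `y` or of `z`, so the problem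
reduces to two variables when the third has nonnegative weight; otherwise `w 1 + w 2 > 0`, from the
generator `yz`, takes over. -/
theorem IsGGraph.pos_of_mem_openCone {r a : ℕ} (har : a < r) {Γ : Set (Fin 3 →₀ ℕ)}
    (hΓ : IsGGraph r a Γ) {w : Fin 3 → ℝ} (hw : w ∈ openCone r a Γ) (i : Fin 3) : 0 < w i := by
  obtain ⟨n0, hn0, hg0, hb0, u0, hu0, hwt0, hz0⟩ := hΓ.exists_power har 0
  obtain ⟨n1, hn1, hg1, hb1, u1, hu1, hwt1, hz1⟩ := hΓ.exists_power har 1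
  obtain ⟨n2, hn2, hg2, hb2, u2, hu2, hwt2, hz2⟩ := hΓ.exists_power har 2
  have h0 := hw _ hg0 _ hu0 hwt0
  have h1 := hw _ hg1 _ hu1 hwt1
  have h2 := hw _ hg2 _ hu2 hwt2
  rw [pairing_single, pairing, Fin.sum_univ_three] at h0 h1 h2
  rw [hz0, Nat.cast_zero, mul_zero, zero_add] at h0
  rw [hz1, Nat.cast_zero, mul_zero, add_zero] at h1
  rw [hz2, Nat.cast_zero, mul_zero, add_zero] at h2
  have hb01 := hb1 _ hu0
  have hb02 := hb2 _ hu0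
  have hb10 := hb0 _ hu1
  have hb12 := hb2 _ hu1
  have hb20 := hb0 _ hu2
  have hb21 := hb1 _ hu2
  have hyz : u0 1 = 0 ∨ u0 2 = 0 := by
    by_contra h
    push Not at h
    exact hΓ.yz_notMem har (hΓ.mem_of_le (le_yz_iff.2
      ⟨Nat.pos_of_ne_zero h.1, Nat.pos_of_ne_zero h.2⟩) hu0)
  have hn1' : (0 : ℝ) < n1 := by exact_mod_cast hn1
  have hn2' : (0 : ℝ) < n2 := by exact_mod_cast hn2
  have key : 0 < w 0 ∧ 0 < w 1 ∧ 0 < w 2 := by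
    have hlast : 0 < w 0 → 0 < w 1 → 0 < w 2 := fun p0 p1 => by
      have : 0 < w 2 * n2 := by
        have := mul_nonneg p0.le (u2 0).cast_nonneg
        have := mul_nonneg p1.le (u2 1).cast_nonneg
        linarith
      exact pos_of_mul_pos_left this hn2'.le
    have hlast' : 0 < w 0 → 0 < w 2 → 0 < w 1 := fun p0 p2 => by
      have : 0 < w 1 * n1 := by
        have := mul_nonneg p0.le (u1 0).cast_nonneg
        have := mul_nonneg p2.le (u1 2).cast_nonneg
        linarith
      exact pos_of_mul_pos_left this hn1'.le
    have via_y : w 2 * (u0 2) = 0 → 0 ≤ w 2 * u1 2 → 0 < w 0 ∧ 0 < w 1 := fun e e' =>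
      pos_of_mul_lt hb01 hb10 (by linarith) (by linarith)
    have via_z : w 1 * (u0 1) = 0 → 0 ≤ w 1 * u2 1 → 0 < w 0 ∧ 0 < w 2 := fun e e' =>
      pos_of_mul_lt hb02 hb20 (by linarith) (by linarith)
    -- In this case `yz` is not a minimal generator, but then `y` or `z` does not occur in `Γ` and
    -- the two-variable argument applies directly.
    by_cases hn : n1 = 1 ∨ n2 = 1
    · rcases hn with rfl | rfl
      · obtain ⟨p0, p2⟩ := via_z (by simp [Nat.lt_one_iff.1 hb01])
          (by simp [Nat.lt_one_iff.1 hb21])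
        exact ⟨p0, hlast' p0 p2, p2⟩
      · obtain ⟨p0, p1⟩ := via_y (by simp [Nat.lt_one_iff.1 hb02])
          (by simp [Nat.lt_one_iff.1 hb12])
        exact ⟨p0, p1, hlast p0 p1⟩
    · push Not at hn
      have hyzgen : Finsupp.single 1 1 + Finsupp.single 2 1 ∈ minGens Γ := by
        refine ⟨hΓ.yz_notMem har, fun u hu hle => ?_⟩
        have e0 : u 0 ≤ 0 := by simpa using hle 0
        have e1 : u 1 ≤ 1 := by simpa using hle 1
        have e2 : u 2 ≤ 1 := by simpa using hle 2
        rw [le_yz_iff]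
        have small : ∀ i k, k < (if i = 1 then n1 else n2) → (i = 1 ∨ i = 2) →
            Finsupp.single i k ∈ Γ := by
          intro i k hk hi
          by_contra hmem
          obtain ⟨g, hg, hle⟩ := exists_minGens_le hmem
          rcases hi with rfl | rfl
          · have := hg1.2 hg.1 (hle.trans (Finsupp.single_le_single.2 (by simpa using hk.le)))
            have := (this.trans hle) 1
            simp at this hk
            omega
          · have := hg2.2 hg.1 (hle.trans (Finsupp.single_le_single.2 (by simpa using hk.le)))
            have := (this.trans hle) 2
            simp at this hk
            omega
        constructor
        · by_contra h
          apply hu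
          have : u = Finsupp.single 2 (u 2) := by
            ext j; fin_cases j <;> simp <;> omega
          rw [this]
          exact small 2 _ (by simp; omega) (by simp)
        · by_contra h
          apply hu
          have : u = Finsupp.single 1 (u 1) := by
            ext j; fin_cases j <;> simp <;> omega
          rw [this]
          exact small 1 _ (by simp; omega) (by simp)
      have hsum := hw _ hyzgen 0 hΓ.zero_mem (wt_yz har).symm
      rw [pairing_add_right, pairing_single, pairing_single, pairing_zero_right] at hsum
      norm_num at hsum
      rcases hyz with e | e
      · have e1 : w 1 * (u0 1) = 0 := by simp [e]
        by_cases h : 0 ≤ w 1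
        · obtain ⟨p0, p2⟩ := via_z e1 (by positivity)
          exact ⟨p0, hlast' p0 p2, p2⟩
        · have p2 : 0 < w 2 := by linarith
          have p0 : 0 < w 0 := by
            have : 0 < w 0 * n0 := by
              have := mul_nonneg p2.le (u0 2).cast_nonneg
              linarith
            exact pos_of_mul_pos_left this n0.cast_nonneg
          exact ⟨p0, hlast' p0 p2, p2⟩
      · have e1 : w 2 * (u0 2) = 0 := by simp [e]
        by_cases h : 0 ≤ w 2
        · obtain ⟨p0, p1⟩ := via_y e1 (by positivity)
          exact ⟨p0, p1, hlast p0 p1⟩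
        · have p1 : 0 < w 1 := by linarith
          have p0 : 0 < w 0 := by
            have : 0 < w 0 * n0 := by
              have := mul_nonneg p1.le (u0 1).cast_nonneg
              linarith
            exact pos_of_mul_pos_left this n0.cast_nonneg
          exact ⟨p0, p1, hlast p0 p1⟩
  fin_cases i
  exacts [key.1, key.2.1, key.2.2]

/-! ### Closed cones and their faces through least-weight monomials. -/

/-- The sum of a point of the closed cone and a positive
multiple of a point of the open cone is in the open cone. -/
theorem add_smul_mem_openCone {r a : ℕ} {Γ : Set (Fin 3 →₀ ℕ)} {w w' : Fin 3 → ℝ}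
    (hw : w ∈ closedCone r a Γ) (hw' : w' ∈ openCone r a Γ) {t : ℝ} (ht : 0 < t) :
    w + t • w' ∈ openCone r a Γ := by
  intro u hu u' hu' h
  have h1 := hw u hu u' hu' h
  have h2 := mul_lt_mul_of_pos_left (hw' u hu u' hu' h) ht
  simp only [pairing_add_left, pairing_smul_left]
  linarith

theorem nonneg_of_forall_add_mul_nonneg {x y : ℝ} (h : ∀ t > 0, 0 ≤ x + t * y) : 0 ≤ x := by
  have : Tendsto (fun t : ℝ => x + t * y) (𝓝[>] 0) (𝓝 (x + 0 * y)) :=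
    (Continuous.tendsto (by fun_prop) 0).mono_left nhdsWithin_le_nhds
  rw [zero_mul, add_zero] at this
  exact ge_of_tendsto this (by filter_upwards [self_mem_nhdsWithin] with t ht using h t ht)

theorem IsGGraph.nonneg_of_mem_closedCone {r a : ℕ} (har : a < r) {Γ : Set (Fin 3 →₀ ℕ)}
    (hΓ : IsGGraph r a Γ) (hne : (openCone r a Γ).Nonempty) {w : Fin 3 → ℝ}
    (hw : w ∈ closedCone r a Γ) (i : Fin 3) : 0 ≤ w i := by
  obtain ⟨w', hw'⟩ := hne
  refine nonneg_of_forall_add_mul_nonneg (y := w' i) fun t ht => ?_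
  simpa using (hΓ.pos_of_mem_openCone har (add_smul_mem_openCone hw hw' ht) i).le

/-- Moving slightly into the open cone makes the monomials of `Γ` the only least-weight ones; the
inequalities against all competitors, not just generators, then pass to the limit. -/
theorem IsGGraph.mem_closedCone_iff {r a : ℕ} (har : a < r) {Γ : Set (Fin 3 →₀ ℕ)}
    (hΓ : IsGGraph r a Γ) (hne : (openCone r a Γ).Nonempty) {w : Fin 3 → ℝ} :
    w ∈ closedCone r a Γ ↔ Γ ⊆ minimizers r a w := by
  refine ⟨fun hw u hu u' h => ?_, fun h u _ u' hu' he => h hu' u he.symm⟩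
  obtain ⟨w', hw'⟩ := hne
  rw [← sub_nonneg]
  refine nonneg_of_forall_add_mul_nonneg (y := pairing w' u' - pairing w' u) fun t ht => ?_
  have hm := add_smul_mem_openCone hw hw' ht
  obtain ⟨g, hg, hg'⟩ := exists_minimizer (hΓ.pos_of_mem_openCone har hm) u
  obtain rfl := hΓ.eq_of_wt_eq (hΓ.minimizers_subset hm hg) hu hg'
  have := hg u' h
  simp only [pairing_add_left, pairing_smul_left] at this
  linarith

theorem isGGraph_of_isLowerSet {r a : ℕ} {Γ : Set (Fin 3 →₀ ℕ)} (hΓ : IsLowerSet Γ)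
    (hb : Set.BijOn (wt r a) Γ Set.univ) : IsGGraph r a Γ := by
  refine ⟨⟨_, ⟨Γᶜ, rfl⟩, ?_⟩, hb⟩
  ext u
  rw [Set.mem_ofPred_eq, mem_ideal_span_monomial_image]
  simp only [support_monomial, one_ne_zero, if_false, Finset.mem_singleton, forall_eq, not_exists,
    not_and, Set.mem_compl_iff]
  exact ⟨fun hu v hv hle => hv (hΓ hle hu), fun h => by_contra fun hu => h u hu le_rfl⟩

/-- The weights `1, t, t^2` with `t` transcendental are linearly independent over the integers. The
resulting form serves as a tie-breaker. -/
theorem exists_pairing_injective : ∃ η : Fin 3 → ℝ, Function.Injective (pairing η) := by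
  obtain ⟨t, ht⟩ : ∃ t : ℝ, Transcendental ℤ t :=
    ⟨_, transcendental_liouvilleNumber (le_refl 2)⟩
  refine ⟨![1, t, t ^ 2], fun u u' h => ?_⟩
  have key : ∀ x y z : ℤ, x + y * t + z * t ^ 2 = 0 → x = 0 ∧ y = 0 ∧ z = 0 := by
    intro x y z hxyz
    have hp := (transcendental_iff.1 ht)
      (Polynomial.C x + Polynomial.C y * Polynomial.X + Polynomial.C z * Polynomial.X ^ 2)
      (by simpa using hxyz)
    have h0 := congrArg (fun p => Polynomial.coeff p 0) hp
    have h1 := congrArg (fun p => Polynomial.coeff p 1) hp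
    have h2 := congrArg (fun p => Polynomial.coeff p 2) hp
    simp only [Polynomial.coeff_add, Polynomial.coeff_C_mul, Polynomial.coeff_X,
      Polynomial.coeff_C, Polynomial.coeff_X_pow, Polynomial.coeff_zero] at h0 h1 h2
    norm_num at h0 h1 h2
    exact ⟨h0, h1, h2⟩
  obtain ⟨h0, h1, h2⟩ := key ((u 0 : ℤ) - u' 0) ((u 1 : ℤ) - u' 1) ((u 2 : ℤ) - u' 2) (by
    simp only [pairing, Fin.sum_univ_three] at h
    simp at h ⊢
    linarith)
  ext j
  fin_cases j <;> simp <;> omega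

/-- Every `w` with positive coordinates lies in the cone of some `G`-graph. -/
theorem exists_isGGraph {r a : ℕ} (hr : r ≠ 0) {w : Fin 3 → ℝ} (hw : ∀ i, 0 < w i) :
    ∃ Γ, IsGGraph r a Γ ∧ (openCone r a Γ).Nonempty ∧ Γ ⊆ minimizers r a w := by
  obtain ⟨η, hη⟩ := exists_pairing_injective
  -- Ties of `w` are broken by `η`; a small shift `w + s • η` later witnesses that the open cone is
  -- nonempty.
  let Γ : Set (Fin 3 →₀ ℕ) := {u | u ∈ minimizers r a w ∧
    ∀ u' ∈ minimizers r a w, wt r a u' = wt r a u → pairing η u ≤ pairing η u'}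
  have hG : IsGGraph r a Γ := by
    refine isGGraph_of_isLowerSet ?_ ⟨fun _ _ => Set.mem_univ _, ?_, ?_⟩
    · intro u u' hle hu
      obtain ⟨c, rfl⟩ := exists_add_of_le hle
      refine ⟨mem_minimizers_of_add hu.1, fun u'' hu'' h => ?_⟩
      have := hu.2 _ (add_mem_minimizers hu.1 hu'' h) (wt_add_right_cancel.2 h)
      rw [pairing_add_right, pairing_add_right] at this
      linarith
    · intro u hu u' hu' h
      exact hη (le_antisymm (hu.2 _ hu'.1 h.symm) (hu'.2 _ hu.1 h))
    · intro χ _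
      obtain ⟨k, -, rfl⟩ := exists_wt_single_zero hr χ
      obtain ⟨u, hu, hk⟩ := exists_minimizer (r := r) (a := a) hw (Finsupp.single 0 k)
      obtain ⟨g, ⟨hg1, hg2⟩, hg3⟩ := Set.exists_min_image
        {u' | u' ∈ minimizers r a w ∧ wt r a u' = wt r a (Finsupp.single 0 k)} (pairing η)
        ((finite_minimizers hr hw).subset fun _ h => h.1) ⟨u, hu, hk⟩
      exact ⟨g, ⟨hg1, fun u' h1 h2 => hg3 u' ⟨h1, h2.trans hg2⟩⟩, hg2⟩
  refine ⟨Γ, hG, ?_, fun u hu => hu.1⟩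
  choose ρ hρ hρ' using hG.exists_rep
  obtain ⟨s, hs⟩ := (eventually_add_mul_pos (finite_minGens Γ)
    (fun u => pairing w u - pairing w (ρ u)) (fun u => pairing η u - pairing η (ρ u))
    (fun u hu => by
      rcases ((hρ u).1 u (hρ' u).symm).lt_or_eq with h | h
      · exact Or.inl (sub_pos.2 h)
      · refine Or.inr ⟨by rw [h, sub_self], sub_pos.2 ?_⟩
        have hm := mem_minimizers_of_pairing_le (hρ u).1 (hρ' u).symm h.ge
        refine ((hρ u).2 u hm (hρ' u).symm).lt_of_ne fun he => hu.1 ?_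
        rw [← hη he]
        exact hρ u)).exists
  refine ⟨w + s • η, fun u hu u' hu' h => ?_⟩
  rw [hG.eq_of_wt_eq hu' (hρ u) (h.trans (hρ' u).symm)]
  have := hs u hu
  simp only [pairing_add_left, pairing_smul_left]
  linarith

/-- The cone is cut out by finitely many inequalities. Strict ones survive a small move, and tight
ones are ties, which `p` does not affect. -/
theorem IsGGraph.eventually_mem_closedCone {r a : ℕ} (har : a < r) {Γ : Set (Fin 3 →₀ ℕ)}
    (hΓ : IsGGraph r a Γ) (hne : (openCone r a Γ).Nonempty) {w p : Fin 3 → ℝ}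
    (hw : w ∈ closedCone r a Γ)
    (hp : ∀ u ∈ minimizers r a w, ∀ u' ∈ minimizers r a w, wt r a u = wt r a u' →
      pairing p u = pairing p u') :
    ∀ᶠ s in 𝓝[>] (0 : ℝ), w + s • p ∈ closedCone r a Γ := by
  have hsub := (hΓ.mem_closedCone_iff har hne).1 hw
  choose ρ hρ hρ' using hΓ.exists_rep
  filter_upwards [eventually_add_mul_nonneg (finite_minGens Γ)
    (fun u => pairing w u - pairing w (ρ u)) (fun u => pairing p u - pairing p (ρ u))
    (fun u _ => by
      rcases (hsub (hρ u) u (hρ' u).symm).lt_or_eq with h | h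
      · exact Or.inl (sub_pos.2 h)
      · have hm := mem_minimizers_of_pairing_le (hsub (hρ u)) (hρ' u).symm h.ge
        exact Or.inr ⟨by rw [h, sub_self],
          by rw [hp u hm _ (hsub (hρ u)) (hρ' u).symm, sub_self]⟩)] with s hs
  intro u hu u' hu' h
  rw [hΓ.eq_of_wt_eq hu' (hρ u) (h.trans (hρ' u).symm)]
  have := hs u hu
  simp only [pairing_add_left, pairing_smul_left]
  linarith

/-- Both `w + s • p` and `w - s • p` lie in the cone, so the supporting form, zero at `w` and
nonnegative at both, vanishes at both. -/
theorem IsGGraph.exists_add_smul_mem_face {r a : ℕ} (har : a < r) {Γ : Set (Fin 3 →₀ ℕ)}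
    (hΓ : IsGGraph r a Γ) (hne : (openCone r a Γ).Nonempty) {τ : Set (Fin 3 → ℝ)}
    (hτ : IsFace τ (closedCone r a Γ)) {w p : Fin 3 → ℝ} (hw : w ∈ τ)
    (hp : ∀ u ∈ minimizers r a w, ∀ u' ∈ minimizers r a w, wt r a u = wt r a u' →
      pairing p u = pairing p u') : ∃ s : ℝ, 0 < s ∧ w + s • p ∈ τ := by
  obtain ⟨m, hm, rfl⟩ := hτ
  have h1 := hΓ.eventually_mem_closedCone har hne hw.1 hp
  have h2 := hΓ.eventually_mem_closedCone har hne (p := -p) hw.1 fun u hu u' hu' h => by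
    rw [pairing_neg_left, pairing_neg_left, hp u hu u' hu' h]
  obtain ⟨s, ⟨h1, h2⟩, hs⟩ := ((h1.and h2).and self_mem_nhdsWithin).exists
  refine ⟨s, hs, h1, le_antisymm ?_ (hm _ h1)⟩
  have e1 := hm _ h2
  have e2 := hw.2
  simp only [Fin.sum_univ_three, Pi.add_apply, Pi.smul_apply, Pi.neg_apply, smul_eq_mul] at e1 e2 ⊢
  linarith

/-- The monomials of least weight for a relative interior point of a segment are of least weight
throughout, if some `G`-graph is of least weight at both ends. -/
theorem IsGGraph.minimizers_subset_of_mem_openSegment {r a : ℕ} {Γ : Set (Fin 3 →₀ ℕ)}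
    (hΓ : IsGGraph r a Γ) {p q w : Fin 3 → ℝ} (hp : Γ ⊆ minimizers r a p)
    (hq : Γ ⊆ minimizers r a q) (hw : w ∈ openSegment ℝ p q) :
    minimizers r a w ⊆ minimizers r a p := by
  obtain ⟨A, B, hA, hB, -, rfl⟩ := hw
  intro u hu
  obtain ⟨g, hg, hg'⟩ := hΓ.exists_rep u
  refine mem_minimizers_of_pairing_le (hp hg) hg'.symm ?_
  have h1 := hu g hg'
  simp only [pairing_add_left, pairing_smul_left] at h1
  have h2 := mul_le_mul_of_nonneg_left (hq hg u hg'.symm) hB.le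
  exact le_of_mul_le_mul_left (by linarith) hA

/-- Ties at `w` persist at `p`, so one can also move from `w` slightly away from `p` inside the
cone. Thus `w` lies between two points of the cone, and a supporting form that vanishes at `w`
vanishes at `p`. -/
theorem IsGGraph.mem_face_of_minimizers_subset {r a : ℕ} (har : a < r) {Γ : Set (Fin 3 →₀ ℕ)}
    (hΓ : IsGGraph r a Γ) (hne : (openCone r a Γ).Nonempty) {τ : Set (Fin 3 → ℝ)}
    (hτ : IsFace τ (closedCone r a Γ)) {w p : Fin 3 → ℝ} (hw : w ∈ τ)
    (hp : minimizers r a w ⊆ minimizers r a p) : p ∈ τ := by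
  obtain ⟨m, hm, rfl⟩ := hτ
  have hpC := (hΓ.mem_closedCone_iff har hne).2
    (((hΓ.mem_closedCone_iff har hne).1 hw.1).trans hp)
  have h1 := hΓ.eventually_mem_closedCone har hne (p := w - p) hw.1 fun u hu u' hu' h => by
    rw [pairing_sub_left, pairing_sub_left, pairing_eq_of_mem_minimizers hu hu' h,
      pairing_eq_of_mem_minimizers (hp hu) (hp hu') h]
  obtain ⟨s, h1, hs⟩ := (h1.and self_mem_nhdsWithin).exists
  have hs : 0 < s := hs
  refine ⟨hpC, le_antisymm ?_ (hm _ hpC)⟩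
  have e1 := hm _ h1
  have e2 := hw.2
  simp only [Fin.sum_univ_three, Pi.add_apply, Pi.smul_apply, Pi.sub_apply, smul_eq_mul] at e1 e2 ⊢
  refine le_of_mul_le_mul_left ?_ hs
  linear_combination e1 + (1 + s) * e2

/-! ### Vertices of the slice. -/

theorem IsVertex.sum_eq {r a : ℕ} {v : Fin 3 → ℝ} (hv : IsVertex r a v) : ∑ i, v i = r := by
  obtain ⟨τ, -, h⟩ := hv
  exact (h ▸ Set.mem_singleton v : v ∈ τ ∩ _).2

/-- If `v i = 0`, powers of the `i`-th variable represent every character at cost zero, so `Γ`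
avoids every variable of positive weight. For such a variable `j` the ray through `e_j` lies in the
cone, and the supporting form vanishes on it because its nonnegative terms at `v` sum to zero. The
slice of the face then contains `r e_j`, which must be `v`. -/
theorem IsVertex.pos {r a : ℕ} (ha : 0 < a) (har : a < r) (hra : Nat.Coprime r a)
    {v : Fin 3 → ℝ} (hv : IsVertex r a v) (hne : ∀ i : Fin 3, v ≠ Pi.single i (r : ℝ)) (i : Fin 3) :
    0 < v i := by
  have hsum := hv.sum_eq
  obtain ⟨τ, ⟨Γ, hΓ, hopen, m, hm, rfl⟩, h⟩ := hv
  have hmem : v ∈ {w ∈ closedCone r a Γ | ∑ i, m i * w i = 0} ∩ {w | ∑ i, w i = (r : ℝ)} :=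
    h ▸ Set.mem_singleton v
  have hnn := hΓ.nonneg_of_mem_closedCone har hopen hmem.1.1
  have hsub := (hΓ.mem_closedCone_iff har hopen).1 hmem.1.1
  refine (hnn i).lt_of_ne fun hi => ?_
  have hzero : ∀ j, v j ≠ 0 → ∀ u ∈ Γ, u j = 0 := by
    intro j hj u hu
    obtain ⟨k, hk⟩ := exists_wt_single ha har hra i u
    have h1 := hsub hu _ hk
    rw [pairing_single, ← hi, zero_mul] at h1
    have h2 := (le_pairing hnn u j).trans h1
    by_contra h3
    have : 0 < v j * u j :=
      mul_pos ((hnn j).lt_of_ne hj.symm) (by exact_mod_cast Nat.pos_of_ne_zero h3)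
    linarith
  have hcone : ∀ j, v j ≠ 0 → ∀ c : ℝ, 0 ≤ c → Pi.single j c ∈ closedCone r a Γ := by
    intro j hj c hc u _ u' hu' _
    have h1 : pairing (Pi.single j c) u' = 0 := by
      simp [pairing, Pi.single_apply, hzero j hj u' hu']
    rw [h1]
    refine pairing_nonneg (fun k => ?_) u
    rw [Pi.single_apply]
    split_ifs <;> simp [hc]
  have hmnn : ∀ j, 0 ≤ m j * v j := by
    intro j
    by_cases hj : v j = 0
    · simp [hj]
    · simpa [Pi.single_apply] using hm _ (hcone j hj (v j) (hnn j))
  have hm0 : ∀ j, m j * v j = 0 := fun j =>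
    (Finset.sum_eq_zero_iff_of_nonneg fun j _ => hmnn j).1 hmem.1.2 j (Finset.mem_univ j)
  obtain ⟨j, hj⟩ : ∃ j, v j ≠ 0 := by
    by_contra hall
    push Not at hall
    simp only [hall, Finset.sum_const_zero] at hsum
    have : (r : ℝ) ≠ 0 := by exact_mod_cast (by omega : r ≠ 0)
    exact this hsum.symm
  refine hne j ?_
  have h1 : Pi.single j (r : ℝ) ∈ ({v} : Set (Fin 3 → ℝ)) := by
    rw [h]
    refine ⟨⟨hcone j hj r r.cast_nonneg, ?_⟩, by simp⟩
    simp [Pi.single_apply, (mul_eq_zero.1 (hm0 j)).resolve_right hj]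
  exact h1.symm

/-- At a vertex, the equations of all ties between monomials of least weight determine the
vertex. -/
theorem IsVertex.eq_zero_of_ties {r a : ℕ} (har : a < r) {v : Fin 3 → ℝ} (hv : IsVertex r a v)
    {p : Fin 3 → ℝ} (hsum : ∑ i, p i = 0)
    (hp : ∀ u ∈ minimizers r a v, ∀ u' ∈ minimizers r a v, wt r a u = wt r a u' →
      pairing p u = pairing p u') : p = 0 := by
  obtain ⟨τ, ⟨Γ, hΓ, hopen, hτ⟩, h⟩ := hv
  have hmem : v ∈ τ ∩ {w | ∑ i, w i = (r : ℝ)} := h ▸ Set.mem_singleton v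
  obtain ⟨s, hs, hs'⟩ := hΓ.exists_add_smul_mem_face har hopen hτ hmem.1 hp
  have h1 : v + s • p ∈ ({v} : Set (Fin 3 → ℝ)) := by
    rw [h]
    refine ⟨hs', ?_⟩
    have := hmem.2
    simp only [Set.mem_ofPred_eq] at this
    simp [Finset.sum_add_distrib, ← Finset.mul_sum, hsum, this]
  have h2 : s • p = 0 := by simpa using h1
  exact (smul_eq_zero.1 h2).resolve_left hs.ne'

/-! ### Edges at a vertex. -/

/-- The data of an edge `segment ℝ v q` at a vertex `v` of the slice: the interior points of the
edge share a set of monomials of least weight, which contains a tie and determines the edge. -/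
structure EdgeAt (r a : ℕ) (v q : Fin 3 → ℝ) (E : Set (Fin 3 → ℝ)) : Prop where
  ne : q ≠ v
  eq_segment : E = segment ℝ v q
  pos : ∀ t : ℝ, 0 < t → t < 1 → ∀ i, 0 < (v + t • (q - v)) i
  sum_eq : ∀ t : ℝ, ∑ i, (v + t • (q - v)) i = r
  subset : ∀ t : ℝ, 0 < t → t < 1 → minimizers r a (v + t • (q - v)) ⊆ minimizers r a v
  eq_setOf : ∀ t : ℝ, 0 < t → t < 1 →
    E = {p | ∑ i, p i = (r : ℝ) ∧ minimizers r a (v + t • (q - v)) ⊆ minimizers r a p}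
  tie : ∀ t : ℝ, 0 < t → t < 1 → ∃ u ∈ minimizers r a (v + t • (q - v)),
    ∃ u' ∈ minimizers r a (v + t • (q - v)), u ≠ u' ∧ wt r a u = wt r a u'

theorem mem_openSegment_of_lt {v q : Fin 3 → ℝ} {s t : ℝ} (hst : s < t) (ht : t < 1) :
    v + t • (q - v) ∈ openSegment ℝ (v + s • (q - v)) q := by
  have h1 : 0 < 1 - s := by linarith
  refine ⟨(1 - t) / (1 - s), (t - s) / (1 - s), div_pos (by linarith) h1, div_pos (by linarith) h1,
    by field_simp; ring, ?_⟩
  ext i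
  simp only [Pi.add_apply, Pi.smul_apply, Pi.sub_apply, smul_eq_mul]
  field_simp
  ring

theorem mem_openSegment_of_gt {v q : Fin 3 → ℝ} {s t : ℝ} (hst : t < s) (ht : 0 < t) :
    v + t • (q - v) ∈ openSegment ℝ (v + s • (q - v)) v := by
  have h1 : 0 < s := by linarith
  refine ⟨t / s, (s - t) / s, div_pos ht h1, div_pos (by linarith) h1, by field_simp; ring, ?_⟩
  ext i
  simp only [Pi.add_apply, Pi.smul_apply, Pi.sub_apply, smul_eq_mul]
  field_simp
  ring

/-- The vertex must be an endpoint: were it interior to the segment, its ties would hold along the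
whole segment, although they determine `v`. -/
theorem IsEdge.exists_edgeAt {r a : ℕ} (har : a < r) {v : Fin 3 → ℝ} (hv : IsVertex r a v)
    (hpos : ∀ i, 0 < v i) {E : Set (Fin 3 → ℝ)} (hE : IsEdge r a E) (hvE : v ∈ E) :
    ∃ q, EdgeAt r a v q E := by
  obtain ⟨⟨τ, ⟨Γ, hΓ, hopen, hτ⟩, hE⟩, hseg⟩ := hE
  have hC : ∀ p ∈ E, Γ ⊆ minimizers r a p := by
    intro p hp
    rw [hE] at hp
    obtain ⟨m, hm, rfl⟩ := hτ
    exact (hΓ.mem_closedCone_iff har hopen).1 hp.1.1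
  have hsum : ∀ p ∈ E, ∑ i, p i = r := by
    intro p hp
    rw [hE] at hp
    exact hp.2
  have hnn : ∀ p ∈ E, ∀ i, 0 ≤ p i := fun p hp =>
    hΓ.nonneg_of_mem_closedCone har hopen ((hΓ.mem_closedCone_iff har hopen).2 (hC p hp))
  obtain ⟨q, hq, hseg⟩ : ∃ q, q ≠ v ∧ E = segment ℝ v q := by
    obtain ⟨p, q, hpq, hseg⟩ := hseg
    have hmem := hvE
    rw [hseg, ← insert_endpoints_openSegment] at hmem
    have hpE : p ∈ E := hseg ▸ left_mem_segment ℝ p q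
    have hqE : q ∈ E := hseg ▸ right_mem_segment ℝ p q
    have interior : ∀ p ∈ E, ∀ q ∈ E, v ∈ openSegment ℝ p q → p = v := by
      intro p hp q hq hmem
      have hsub := hΓ.minimizers_subset_of_mem_openSegment (hC p hp) (hC q hq) hmem
      refine sub_eq_zero.1 (hv.eq_zero_of_ties har ?_ fun u hu u' hu' h => ?_)
      · simp [hsum p hp, hv.sum_eq]
      · rw [pairing_sub_left, pairing_sub_left, pairing_eq_of_mem_minimizers hu hu' h,
          pairing_eq_of_mem_minimizers (hsub hu) (hsub hu') h]
    rcases hmem with h | h | h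
    · exact ⟨q, by rw [h]; exact hpq.symm, by rw [h, hseg]⟩
    · rw [Set.mem_singleton_iff.1 h]
      exact ⟨p, hpq, by rw [hseg, segment_symm]⟩
    · have h1 := interior p hpE q hqE h
      have h2 := interior q hqE p hpE (by rwa [openSegment_symm])
      exact absurd (h1.trans h2.symm) hpq
  have hqE : q ∈ E := hseg ▸ right_mem_segment ℝ v q
  have hpt : ∀ t : ℝ, 0 ≤ t → t ≤ 1 → v + t • (q - v) ∈ E := by
    intro t h0 h1
    rw [hseg, segment_eq_image']
    exact ⟨t, ⟨h0, h1⟩, rfl⟩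
  have hsub : ∀ t : ℝ, 0 < t → t < 1 →
      E ⊆ {p | minimizers r a (v + t • (q - v)) ⊆ minimizers r a p} := by
    intro t h0 h1 p hp
    have hp' := hp
    rw [hseg, segment_eq_image'] at hp'
    obtain ⟨s, -, rfl⟩ := hp'
    rcases lt_trichotomy s t with h | h | h
    · exact hΓ.minimizers_subset_of_mem_openSegment (hC _ hp) (hC _ hqE)
        (mem_openSegment_of_lt h h1)
    · rw [h]; exact Set.Subset.rfl
    · exact hΓ.minimizers_subset_of_mem_openSegment (hC _ hp) (hC _ hvE)
        (mem_openSegment_of_gt h h0)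
  have hsum' : ∀ t : ℝ, ∑ i, (v + t • (q - v)) i = r := by
    intro t
    simp [Finset.sum_add_distrib, ← Finset.mul_sum, hsum q hqE, hsum v hvE]
  refine ⟨q, hq, hseg, ?_, hsum', ?_, ?_, ?_⟩
  · intro t h0 h1 i
    simp only [Pi.add_apply, Pi.smul_apply, Pi.sub_apply, smul_eq_mul]
    have h2 := mul_nonneg h0.le (hnn q hqE i)
    have h3 := mul_pos (sub_pos.2 h1) (hpos i)
    linarith
  · intro t h0 h1
    exact hsub t h0 h1 hvE
  · intro t h0 h1
    refine Set.Subset.antisymm (fun p hp => ⟨hsum p hp, hsub t h0 h1 hp⟩) fun p hp => ?_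
    rw [hE]
    have hw := hpt t h0.le h1.le
    rw [hE] at hw
    exact ⟨hΓ.mem_face_of_minimizers_subset har hopen hτ hw.1 hp.2, hp.1⟩
  · intro t h0 h1
    by_contra hno
    push Not at hno
    have hw := hpt t h0.le h1.le
    rw [hE] at hw
    -- Without a tie the face would allow a small move in every direction of the plane, so all these
    -- directions would be parallel to `q - v`.
    have hdir : ∀ η : Fin 3 → ℝ, ∑ i, η i = 0 → ∃ c : ℝ, η = c • (q - v) := by
      intro η hη
      obtain ⟨s, hs, hs'⟩ := hΓ.exists_add_smul_mem_face har hopen hτ (p := η) hw.1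
        fun u hu u' hu' h => by
          by_contra hne
          exact hno u hu u' hu' (fun e => hne (by rw [e])) h
      have hmem : v + t • (q - v) + s • η ∈ E := by
        rw [hE]
        refine ⟨hs', ?_⟩
        have := hsum' t
        simp only [Set.mem_ofPred_eq, Pi.add_apply, Finset.sum_add_distrib] at this ⊢
        simp only [Pi.smul_apply, smul_eq_mul, ← Finset.mul_sum, hη] at this ⊢
        linarith
      rw [hseg, segment_eq_image'] at hmem
      obtain ⟨c, -, hc⟩ := hmem
      refine ⟨s⁻¹ * (c - t), ?_⟩
      have h2 : s • η = (c - t) • (q - v) := by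
        rw [sub_smul]
        have : v + c • (q - v) = v + t • (q - v) + s • η := hc
        linear_combination (exp := 1) -this
      rw [mul_smul, ← h2, smul_smul, inv_mul_cancel₀ hs.ne', one_smul]
    obtain ⟨c, hc⟩ := hdir ![1, -1, 0] (by simp [Fin.sum_univ_three])
    obtain ⟨d, hd⟩ := hdir ![0, 1, -1] (by simp [Fin.sum_univ_three])
    have c0 := congrFun hc 0
    have c2 := congrFun hc 2
    have d2 := congrFun hd 2
    simp at c0 c2 d2
    rcases c2 with h | h
    · simp [h] at c0
    · simp [h] at d2

/-- Edges at a vertex in the same direction coincide. -/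
theorem EdgeAt.eq_of_ray {r a : ℕ} {v q q' : Fin 3 → ℝ} {E E' : Set (Fin 3 → ℝ)}
    (hE : EdgeAt r a v q E) (hE' : EdgeAt r a v q' E') {c : ℝ} (hc : 0 < c)
    (h : q' - v = c • (q - v)) : E = E' := by
  have h1 : (0 : ℝ) < 1 + c := by linarith
  -- These parameters lie strictly between `0` and `1` and give the same point on both segments.
  rw [hE.eq_setOf (c / (1 + c)) (by positivity) (by rw [div_lt_one h1]; linarith),
    hE'.eq_setOf (1 / (1 + c)) (by positivity) (by rw [div_lt_one h1]; linarith), h, smul_smul]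
  have : 1 / (1 + c) * c = c / (1 + c) := by ring
  rw [this]

/-! ### Normal form of ties and labels of edges. -/

/-- The index of the variable `y` or `z`. -/
def idx : Bool → Fin 3
  | true => 1
  | false => 2

/-- The monomial `x ^ i y ^ j z ^ k`, or the same with `y` and `z` interchanged. -/
noncomputable def mono (s : Bool) (i j k : ℕ) : Fin 3 →₀ ℕ :=
  Finsupp.single 0 i + Finsupp.single (idx s) j + Finsupp.single (idx !s) k

theorem mono_not (s : Bool) (i j k : ℕ) : mono (!s) i j k = mono s i k j := by
  simp [mono, add_right_comm]

theorem mono_add (s : Bool) (i j k i' j' k' : ℕ) :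
    mono s i j k + mono s i' j' k' = mono s (i + i') (j + j') (k + k') := by
  simp only [mono, Finsupp.single_add]
  abel

theorem eq_mono_true (u : Fin 3 →₀ ℕ) : u = mono true (u 0) (u 1) (u 2) := by
  ext i; fin_cases i <;> simp [mono, idx]

theorem pairing_mono (w : Fin 3 → ℝ) (s : Bool) (i j k : ℕ) :
    pairing w (mono s i j k) = w 0 * i + w (idx s) * j + w (idx !s) * k := by
  simp [mono, pairing_add_right, pairing_single]

theorem sum_idx (w : Fin 3 → ℝ) (s : Bool) : ∑ i, w i = w 0 + w (idx s) + w (idx !s) := by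
  cases s <;> simp [Fin.sum_univ_three, idx]; ring

theorem wt_mono_yz {r a : ℕ} (har : a < r) (s : Bool) (i j k : ℕ) :
    wt r a (mono s i (j + 1) (k + 1)) = wt r a (mono s i j k) := by
  have h : mono s 0 1 1 = Finsupp.single 1 1 + Finsupp.single 2 1 := by
    cases s <;> simp [mono, idx, add_comm]
  rw [show mono s i (j + 1) (k + 1) = mono s i j k + mono s 0 1 1 by rw [mono_add]; simp,
    wt_add, h, wt_yz har, ← wt_add, add_zero]

theorem eq_zero_or_eq_zero_of_mono_mem_minimizers {r a : ℕ} (har : a < r) {w : Fin 3 → ℝ}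
    (hw : ∀ i, 0 < w i) {s : Bool} {i j k : ℕ} (h : mono s i j k ∈ minimizers r a w) :
    j = 0 ∨ k = 0 := by
  rcases j with _ | j
  · exact Or.inl rfl
  rcases k with _ | k
  · exact Or.inr rfl
  have := h _ (wt_mono_yz har s i j k).symm
  rw [pairing_mono, pairing_mono] at this
  push_cast at this
  linarith [hw (idx s), hw (idx !s)]

/-- The position of `w` relative to `v`: the sign tells whether, from `v` to `w`, the weight of `x`
increases relative to that of the variable other than `idx s`. -/
def cross (v w : Fin 3 → ℝ) (s : Bool) : ℝ :=
  w 0 * v (idx !s) - w (idx !s) * v 0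

/-- The tie equation with `e ≠ 0` and the vanishing of `cross` make `x` parallel to `v`, whose
coordinate sum is positive. -/
theorem eq_zero_of_cross_eq_zero {v x : Fin 3 → ℝ} (hv : ∀ i, 0 < v i) (hx : ∑ i, x i = 0)
    {s : Bool} {d e f : ℝ} (he : e ≠ 0) (hdv : d * v 0 + e * v (idx s) + f * v (idx !s) = 0)
    (hdx : d * x 0 + e * x (idx s) + f * x (idx !s) = 0) (hc : cross v x s = 0) : x = 0 := by
  rw [sum_idx x s] at hx
  unfold cross at hc
  have h0 := hv 0
  have h1 := hv (idx s)
  have h2 := hv (idx !s)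
  have e1 : x (idx s) * v 0 = x 0 * v (idx s) := by
    apply mul_left_cancel₀ he
    linear_combination v 0 * hdx - x 0 * hdv + f * hc
  have e2 : x 0 * (v 0 + v (idx s) + v (idx !s)) = 0 := by
    linear_combination v 0 * hx - e1 + hc
  have x0 : x 0 = 0 := (mul_eq_zero.1 e2).resolve_right (by positivity)
  have x1 : x (idx s) = 0 := by
    rw [x0, zero_mul] at e1
    exact (mul_eq_zero.1 e1).resolve_right h0.ne'
  have x2 : x (idx !s) = 0 := by rw [x0, x1] at hx; linarith
  ext i
  cases s <;> fin_cases i <;> assumption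

/-- On the line cut out by the tie, `cross v · s` is an affine coordinate vanishing only at `v`; the
scalar is the ratio of the two coordinates. -/
theorem exists_pos_smul_of_cross {v w w' : Fin 3 → ℝ} (hv : ∀ i, 0 < v i)
    (hw : ∑ i, w i = ∑ i, v i) (hw' : ∑ i, w' i = ∑ i, v i)
    {s : Bool} {d e f : ℝ} (he : e ≠ 0) (hdv : d * v 0 + e * v (idx s) + f * v (idx !s) = 0)
    (hdw : d * w 0 + e * w (idx s) + f * w (idx !s) = 0)
    (hdw' : d * w' 0 + e * w' (idx s) + f * w' (idx !s) = 0)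
    (hc : 0 < cross v w s * cross v w' s) : ∃ c : ℝ, 0 < c ∧ w' - v = c • (w - v) := by
  have hne : cross v w s ≠ 0 := by
    intro h
    rw [h, zero_mul] at hc
    exact lt_irrefl _ hc
  refine ⟨cross v w' s / cross v w s, ?_, ?_⟩
  · rw [div_eq_mul_inv, ← mul_pos_iff_of_pos_right (pow_pos (abs_pos.2 hne) 2), sq_abs]
    field_simp
    rw [mul_comm]
    exact hc
  · rw [← sub_eq_zero]
    set t := cross v w' s / cross v w s with ht
    have ht' : t * cross v w s = cross v w' s := div_mul_cancel₀ _ hne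
    refine eq_zero_of_cross_eq_zero (s := s) (d := d) (e := e) (f := f) hv ?_ he hdv ?_ ?_
    · simp [← Finset.mul_sum, hw, hw']
    · simp only [Pi.sub_apply, Pi.smul_apply, smul_eq_mul]
      linear_combination hdw' - t * hdw + (t - 1) * hdv
    · simp only [cross, Pi.sub_apply, Pi.smul_apply, smul_eq_mul] at ht' ⊢
      linear_combination -ht'

/-- The labels of edges at a vertex. The first entry singles out one of the variables `y` and `z`
(called `y` here), the second tells whether on the edge there is a tie `x ^ n ~ y ^ j` (`false`) or
a tie `x ^ i y ^ j ~ z ^ k` (`true`), and the third is a side of the corresponding plane. -/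
def HasLabel (r a : ℕ) (v w : Fin 3 → ℝ) : Bool × Bool × Bool → Prop
  | (s, false, p) => (∃ n j, 0 < n ∧ 0 < j ∧ mono s n 0 0 ∈ minimizers r a w ∧
      mono s 0 j 0 ∈ minimizers r a w ∧ wt r a (mono s n 0 0) = wt r a (mono s 0 j 0)) ∧
      if p then 0 < cross v w s else cross v w s < 0
  | (s, true, p) => (∃ i j k, 0 < j ∧ 0 < k ∧ mono s i j 0 ∈ minimizers r a w ∧
      mono s 0 0 k ∈ minimizers r a w ∧ wt r a (mono s i j 0) = wt r a (mono s 0 0 k)) ∧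
      if p then 0 < cross v w s else cross v w s < 0

/-- The side without `x` is a pure power of `y` or `z`, as `yz` cannot divide it; disjointness
removes that variable from the other side. -/
theorem exists_mono_tie_of_zero {r a : ℕ} (har : a < r) {w : Fin 3 → ℝ} (hw : ∀ i, 0 < w i)
    {u u' : Fin 3 →₀ ℕ} (hu : u ∈ minimizers r a w) (hu' : u' ∈ minimizers r a w) (hne : u ≠ u')
    (hwt : wt r a u = wt r a u') (hdisj : ∀ i, u i = 0 ∨ u' i = 0) (h0 : u' 0 = 0) :
    ∃ s i j k, 0 < k ∧ (0 < i ∨ 0 < j) ∧ mono s i j 0 ∈ minimizers r a w ∧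
      mono s 0 0 k ∈ minimizers r a w ∧ wt r a (mono s i j 0) = wt r a (mono s 0 0 k) := by
  have hp := pairing_eq_of_mem_minimizers hu hu' hwt
  have hu0 : u ≠ 0 := by
    rintro rfl
    rw [pairing_zero_right] at hp
    exact (pairing_pos hw hne.symm).ne hp
  have hu'0 : u' ≠ 0 := by
    rintro rfl
    rw [pairing_zero_right] at hp
    exact (pairing_pos hw hne).ne' hp
  have eu := eq_mono_true u
  have eu' := eq_mono_true u'
  have hyz : u' 1 = 0 ∨ u' 2 = 0 :=
    eq_zero_or_eq_zero_of_mono_mem_minimizers har hw (eu' ▸ hu')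
  have hu0' : ¬ (u 0 = 0 ∧ u 1 = 0 ∧ u 2 = 0) := by
    rintro ⟨h1, h2, h3⟩
    rw [h1, h2, h3] at eu
    exact hu0 (by simpa [mono] using eu)
  have hu'0' : ¬ (u' 0 = 0 ∧ u' 1 = 0 ∧ u' 2 = 0) := by
    rintro ⟨h1, h2, h3⟩
    rw [h1, h2, h3] at eu'
    exact hu'0 (by simpa [mono] using eu')
  rcases hyz with h | h
  · have h2 : 0 < u' 2 := by omega
    have h3 : u 2 = 0 := (hdisj 2).resolve_right h2.ne'
    rw [h0, h] at eu'
    rw [h3] at eu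
    exact ⟨true, u 0, u 1, u' 2, h2, by omega, eu ▸ hu, eu' ▸ hu', by rw [← eu, ← eu', hwt]⟩
  · have h2 : 0 < u' 1 := by omega
    have h3 : u 1 = 0 := (hdisj 1).resolve_right h2.ne'
    rw [h0, h, ← mono_not] at eu'
    rw [h3, ← mono_not] at eu
    exact ⟨false, u 0, u 2, u' 1, h2, by omega, eu ▸ hu, eu' ▸ hu',
      (congrArg _ eu.symm).trans (hwt.trans (congrArg _ eu'))⟩

theorem exists_mono_tie {r a : ℕ} (har : a < r) {w : Fin 3 → ℝ} (hw : ∀ i, 0 < w i)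
    {u u' : Fin 3 →₀ ℕ} (hu : u ∈ minimizers r a w) (hu' : u' ∈ minimizers r a w) (hne : u ≠ u')
    (hwt : wt r a u = wt r a u') :
    ∃ s i j k, 0 < k ∧ (0 < i ∨ 0 < j) ∧ mono s i j 0 ∈ minimizers r a w ∧
      mono s 0 0 k ∈ minimizers r a w ∧ wt r a (mono s i j 0) = wt r a (mono s 0 0 k) := by
  obtain ⟨b, hb⟩ : ∃ b, u = b + u ⊓ u' := ⟨u - u ⊓ u', (tsub_add_cancel_of_le inf_le_left).symm⟩
  obtain ⟨b', hb'⟩ : ∃ b', u' = b' + u ⊓ u' :=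
    ⟨u' - u ⊓ u', (tsub_add_cancel_of_le inf_le_right).symm⟩
  have hdisj : ∀ i, b i = 0 ∨ b' i = 0 := by
    intro i
    have h1 := DFunLike.congr_fun hb i
    have h2 := DFunLike.congr_fun hb' i
    simp only [Finsupp.add_apply, Finsupp.inf_apply] at h1 h2
    omega
  have hwtb : wt r a b = wt r a b' := by
    rw [← wt_add_right_cancel (c := u ⊓ u'), ← hb, ← hb', hwt]
  have hbne : b ≠ b' := fun h => hne (hb.trans (h ▸ hb'.symm))
  have hbm := mem_minimizers_of_add (hb ▸ hu)
  have hbm' := mem_minimizers_of_add (hb' ▸ hu')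
  rcases hdisj 0 with h | h
  · exact exists_mono_tie_of_zero har hw hbm' hbm hbne.symm hwtb.symm
      (fun i => (hdisj i).symm) h
  · exact exists_mono_tie_of_zero har hw hbm hbm' hbne hwtb hdisj h

theorem exists_hasLabel {r a : ℕ} (har : a < r) {v w : Fin 3 → ℝ} (hv : ∀ i, 0 < v i)
    (hw : ∀ i, 0 < w i) (hsum : ∑ i, w i = ∑ i, v i) (hne : w ≠ v)
    (hsub : minimizers r a w ⊆ minimizers r a v) {u u' : Fin 3 →₀ ℕ}
    (hu : u ∈ minimizers r a w) (hu' : u' ∈ minimizers r a w) (huu' : u ≠ u')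
    (hwt : wt r a u = wt r a u') : ∃ l, HasLabel r a v w l := by
  obtain ⟨s, i, j, k, hk, hij, h1, h2, h12⟩ := exists_mono_tie har hw hu hu' huu' hwt
  have ew := pairing_eq_of_mem_minimizers h1 h2 h12
  have ev := pairing_eq_of_mem_minimizers (hsub h1) (hsub h2) h12
  rw [pairing_mono, pairing_mono] at ew ev
  simp only [Nat.cast_zero, mul_zero, add_zero, zero_add] at ew ev
  have key : ∀ (s : Bool) (d e f : ℝ), e ≠ 0 → d * v 0 + e * v (idx s) + f * v (idx !s) = 0 →
      d * w 0 + e * w (idx s) + f * w (idx !s) = 0 →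
      ∃ p : Bool, if p then 0 < cross v w s else cross v w s < 0 := by
    intro s d e f he hdv hdw
    have hc : cross v w s ≠ 0 := by
      intro hc
      refine hne (sub_eq_zero.1 (eq_zero_of_cross_eq_zero (s := s) (d := d) (e := e) (f := f)
        hv ?_ he hdv ?_ ?_))
      · simp [hsum]
      · simp only [Pi.sub_apply]
        linear_combination hdw - hdv
      · simp only [cross, Pi.sub_apply] at hc ⊢
        linear_combination hc
    rcases hc.lt_or_gt with h | h
    · exact ⟨false, by simpa using h⟩
    · exact ⟨true, by simpa using h⟩
  -- With `j = 0` the tie is between powers of `x` and `z`, which has the axis shape once `y` and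
  -- `z` swap names.
  rcases Nat.eq_zero_or_pos j with rfl | hj
  · obtain ⟨p, hp⟩ := key (!s) i (-k) 0 (neg_ne_zero.2 (by exact_mod_cast hk.ne'))
      (by push_cast at ev; linear_combination ev) (by push_cast at ew; linear_combination ew)
    refine ⟨(!s, false, p), ⟨i, k, hij.resolve_right (lt_irrefl 0), hk, ?_⟩, hp⟩
    rw [mono_not, mono_not]
    exact ⟨h1, h2, h12⟩
  · obtain ⟨p, hp⟩ := key s i j (-k) (by exact_mod_cast hj.ne')
      (by linear_combination ev) (by linear_combination ew)
    exact ⟨(s, true, p), ⟨i, j, k, hj, hk, h1, h2, h12⟩, hp⟩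

/-! ### Uniqueness and exclusion of labels; the upper bound. -/

section Labels

variable {r a : ℕ} {v w w' : Fin 3 → ℝ}

theorem mul_cross_pos {s p : Bool} (h : if p then 0 < cross v w s else cross v w s < 0)
    (h' : if p then 0 < cross v w' s else cross v w' s < 0) :
    0 < cross v w s * cross v w' s := by
  cases p
  · exact mul_pos_of_neg_of_neg (by simpa using h) (by simpa using h')
  · exact mul_pos (by simpa using h) (by simpa using h')

/-- Otherwise replacing `z^k` by `x^i y^j` inside `z^k'` gives a least-weight monomial divisible by
`yz`. Thus the exponent of `z` in such a tie is the largest one of least weight at `v`. -/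
theorem le_of_tie (har : a < r) (hv : ∀ i, 0 < v i) {s : Bool} {i j k k' : ℕ} {u : Fin 3 →₀ ℕ}
    (hu : u = mono s i j 0) (hj : 0 < j) (hum : u ∈ minimizers r a v)
    (hwt : wt r a u = wt r a (mono s 0 0 k)) (hk' : mono s 0 0 k' ∈ minimizers r a v) :
    k' ≤ k := by
  by_contra hlt
  have e : mono s 0 0 k' = mono s 0 0 k + mono s 0 0 (k' - k) := by
    rw [mono_add]; congr 1; omega
  rw [e] at hk'
  have := add_mem_minimizers hk' hum hwt
  rw [hu, mono_add] at this
  rcases eq_zero_or_eq_zero_of_mono_mem_minimizers har hv this with h | h <;> omega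

theorem HasLabel.exists_pos_smul (har : a < r) (hv : ∀ i, 0 < v i)
    (hw : ∑ i, w i = ∑ i, v i) (hw' : ∑ i, w' i = ∑ i, v i)
    (hsub : minimizers r a w ⊆ minimizers r a v) (hsub' : minimizers r a w' ⊆ minimizers r a v)
    {l : Bool × Bool × Bool} (h : HasLabel r a v w l) (h' : HasLabel r a v w' l) :
    ∃ c : ℝ, 0 < c ∧ w' - v = c • (w - v) := by
  obtain ⟨s, t, p⟩ := l
  cases t
  · obtain ⟨⟨n, j, hn, hj, m1, m2, m12⟩, hp⟩ := h
    obtain ⟨⟨n', j', hn', hj', m1', m2', m12'⟩, hp'⟩ := h'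
    have ew := pairing_eq_of_mem_minimizers m1 m2 m12
    -- Both axis ties hold at `v`, so their exponents are proportional and they define the same
    -- plane.
    have ev := pairing_eq_of_mem_minimizers (hsub m1) (hsub m2) m12
    have ew' := pairing_eq_of_mem_minimizers m1' m2' m12'
    have ev' := pairing_eq_of_mem_minimizers (hsub' m1') (hsub' m2') m12'
    simp only [pairing_mono, Nat.cast_zero, mul_zero, add_zero, zero_add] at ew ev ew' ev'
    have hn'0 : (n' : ℝ) ≠ 0 := by exact_mod_cast hn'.ne'
    have hpar : (n' : ℝ) * j = n * j' := by
      apply mul_left_cancel₀ (hv (idx s)).ne'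
      linear_combination n * ev' - n' * ev
    refine exists_pos_smul_of_cross (s := s) (d := n) (e := -j) (f := 0) hv hw hw'
      (neg_ne_zero.2 (by exact_mod_cast hj.ne')) (by linear_combination ev)
      (by linear_combination ew) ?_ (mul_cross_pos hp hp')
    apply mul_left_cancel₀ hn'0
    linear_combination n * ew' - w' (idx s) * hpar
  · obtain ⟨⟨i, j, k, hj, hk, m1, m2, m12⟩, hp⟩ := h
    obtain ⟨⟨i', j', k', hj', hk', m1', m2', m12'⟩, hp'⟩ := h'
    obtain rfl : k = k' := le_antisymm
      (le_of_tie har hv rfl hj' (hsub' m1') m12' (hsub m2))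
      (le_of_tie har hv rfl hj (hsub m1) m12 (hsub' m2'))
    have ew := pairing_eq_of_mem_minimizers m1 m2 m12
    have ev := pairing_eq_of_mem_minimizers (hsub m1) (hsub m2) m12
    have ew' := pairing_eq_of_mem_minimizers m1' m2' m12'
    have ev' := pairing_eq_of_mem_minimizers (hsub' m1') (hsub' m2') m12'
    have iw := m1 _ (m12'.trans m12.symm)
    have iw' := m1' _ (m12.trans m12'.symm)
    simp only [pairing_mono, Nat.cast_zero, mul_zero, add_zero, zero_add] at ew ev ew' ev' iw iw'
    have hvz := hv (idx !s)
    have hj0 : (0 : ℝ) < j := by exact_mod_cast hj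
    have hj0' : (0 : ℝ) < j' := by exact_mod_cast hj'
    have hk0 : (0 : ℝ) < k := by exact_mod_cast hk
    -- The powers of `z` agree, so `x^i y^j` and `x^i' y^j'` compete. Minimality of the first at `w`
    -- and of the second at `w'`, on the same side of `v`, bounds `i' * j - i * j'` from both
    -- directions and forces it to be zero.
    have c1 : 0 ≤ cross v w s * (i' * j - i * j') := by
      have := mul_nonneg (mul_nonneg hvz.le hj0.le) (sub_nonneg.2 iw)
      simp only [cross]
      linear_combination this + v (idx !s) * (j' - j) * ew - w (idx !s) * j' * ev
        + w (idx !s) * j * ev'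
    have c2 : 0 ≤ cross v w' s * (i * j' - i' * j) := by
      have := mul_nonneg (mul_nonneg hvz.le hj0'.le) (sub_nonneg.2 iw')
      simp only [cross]
      linear_combination this + v (idx !s) * (j - j') * ew' - w' (idx !s) * j * ev'
        + w' (idx !s) * j' * ev
    have hpar : (i' * j - i * j' : ℝ) = 0 := by
      have hc := mul_cross_pos hp hp'
      cases p
      · simp only [Bool.false_eq_true, if_false] at hp hp'
        nlinarith
      · simp only [if_true] at hp hp'
        nlinarith
    -- Proportional exponents with the same positive weight at `v` are equal.
    have hjj : (j' : ℝ) = j := by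
      have : (j' - j : ℝ) * (v (idx !s) * k) = 0 := by
        linear_combination j * ev' - j' * ev - v 0 * hpar
      have := (mul_eq_zero.1 this).resolve_right (by positivity)
      linarith
    have hii : (i' : ℝ) = i := by
      rw [hjj] at hpar
      have : (i' - i : ℝ) * j = 0 := by linear_combination hpar
      have := (mul_eq_zero.1 this).resolve_right hj0.ne'
      linarith
    rw [hjj, hii] at ew'
    exact exists_pos_smul_of_cross (s := s) (d := i) (e := j) (f := -k) hv hw hw' hj0.ne'
      (by linear_combination ev) (by linear_combination ew) (by linear_combination ew')
      (mul_cross_pos hp hp')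

/-- Here `m ≤ k`, so `x^n` may replace `z^m` inside `z^k`. Minimality of `z^k` at `w`, with the tie
`x^n ~ z^m` at `v`, makes `cross v w s` nonnegative. -/
theorem HasLabel.not_inner_of_axis (har : a < r) (hv : ∀ i, 0 < v i)
    (hsub : minimizers r a w ⊆ minimizers r a v) (hsub' : minimizers r a w' ⊆ minimizers r a v)
    {s p : Bool} (h : HasLabel r a v w (s, true, false))
    (h' : HasLabel r a v w' (!s, false, p)) : False := by
  obtain ⟨⟨i, j, k, hj, hk, m1, m2, m12⟩, hp⟩ := h
  obtain ⟨⟨n, m, hn, hm, n1, n2, n12⟩, -⟩ := h'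
  rw [mono_not] at n1 n2
  rw [mono_not, mono_not] at n12
  have hmk := le_of_tie har hv rfl hj (hsub m1) m12 (hsub' n2)
  have ev := pairing_eq_of_mem_minimizers (hsub' n1) (hsub' n2) n12
  have e : mono s 0 0 k = mono s 0 0 m + mono s 0 0 (k - m) := by
    rw [mono_add]; congr 1; omega
  have iw := m2 (mono s n 0 0 + mono s 0 0 (k - m))
    (by rw [e]; exact wt_add_right_cancel.2 n12)
  rw [e, pairing_add_right, pairing_add_right] at iw
  simp only [pairing_mono, Nat.cast_zero, mul_zero, add_zero, zero_add] at ev iw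
  simp only [Bool.false_eq_true, if_false, cross] at hp
  have hn0 : (0 : ℝ) < n := by exact_mod_cast hn
  have h1 : 0 ≤ v (idx !s) * (w 0 * n - w (idx !s) * m) :=
    mul_nonneg (hv _).le (by linarith)
  have h2 := mul_neg_of_neg_of_pos hp hn0
  linarith [congrArg (w (idx !s) * ·) ev]

/-- The smaller of the two powers of `x` divides the larger one. Replacing it there by the power it
is tied with contradicts minimality of the larger one, on the edge whose tie contains it. -/
theorem HasLabel.not_axes (hv : ∀ i, 0 < v i)
    (hsub : minimizers r a w ⊆ minimizers r a v) (hsub' : minimizers r a w' ⊆ minimizers r a v)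
    {s : Bool} (h : HasLabel r a v w (s, false, true))
    (h' : HasLabel r a v w' (!s, false, true)) : False := by
  have key : ∀ {s : Bool} {w w' : Fin 3 → ℝ}, minimizers r a w' ⊆ minimizers r a v →
      ∀ {n j n' j' : ℕ}, 0 < n' → mono s n 0 0 ∈ minimizers r a w →
      mono s n' 0 0 ∈ minimizers r a w' → mono s 0 0 j' ∈ minimizers r a w' →
      wt r a (mono s n' 0 0) = wt r a (mono s 0 0 j') → 0 < cross v w s → n' ≤ n → False := by
    intro s w w' hsub' n j n' j' hn' m1 n1 n2 n12 hc hle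
    have ev := pairing_eq_of_mem_minimizers (hsub' n1) (hsub' n2) n12
    have e : mono s n 0 0 = mono s n' 0 0 + mono s (n - n') 0 0 := by
      rw [mono_add]; congr 1; omega
    have iw := m1 (mono s 0 0 j' + mono s (n - n') 0 0)
      (by rw [e]; exact wt_add_right_cancel.2 n12.symm)
    rw [e, pairing_add_right, pairing_add_right] at iw
    simp only [pairing_mono, Nat.cast_zero, mul_zero, add_zero, zero_add] at ev iw
    simp only [cross] at hc
    have hn0 : (0 : ℝ) < n' := by exact_mod_cast hn'
    have h1 : 0 ≤ v (idx !s) * (w (idx !s) * j' - w 0 * n') :=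
      mul_nonneg (hv _).le (by linarith)
    have h2 := mul_pos hc hn0
    linarith [congrArg (w (idx !s) * ·) ev]
  obtain ⟨⟨n, j, hn, hj, m1, m2, m12⟩, hp⟩ := h
  obtain ⟨⟨n', j', hn', hj', n1, n2, n12⟩, hp'⟩ := h'
  simp only [if_true] at hp hp'
  rcases le_total n' n with h | h
  · rw [mono_not] at n1 n2
    rw [mono_not, mono_not] at n12
    exact key hsub' (j := j) hn' m1 n1 n2 n12 hp h
  · rw [← mono_not] at m1 m2
    rw [← mono_not, ← mono_not s] at m12
    exact key hsub (j := j') hn n1 m1 m2 m12 hp' h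

end Labels

/-- The hypotheses contain three disjoint pairs of mutually exclusive labels; only the two labels
`(s, true, true)` remain free. -/
theorem card_labels_le (F : Finset (Bool × Bool × Bool))
    (h1 : ∀ s p, (s, true, false) ∈ F → (!s, false, p) ∉ F)
    (h2 : ∀ s, (s, false, true) ∈ F → (!s, false, true) ∉ F) : F.card ≤ 5 := by
  have key : ∀ l l', (l ∈ F → l' ∉ F) →
      (if l ∈ F then 1 else 0) + (if l' ∈ F then 1 else 0) ≤ 1 := by
    intro l l' h
    split_ifs <;> simp_all
  have one : ∀ l, (if l ∈ F then 1 else 0) ≤ 1 := by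
    intro l
    split_ifs <;> simp
  have hcard : F.card = ∑ l, if l ∈ F then 1 else 0 := by simp
  rw [hcard]
  simp only [Fintype.sum_prod_type, Fintype.sum_bool]
  have := key _ _ (h1 true false)
  have := key _ _ (h1 false false)
  have := key _ _ (h2 true)
  have := one (true, true, true)
  have := one (false, true, true)
  simp only [Bool.not_true, Bool.not_false] at *
  omega

theorem degree_le_five {r a : ℕ} (har : a < r) {v : Fin 3 → ℝ} (hv : IsVertex r a v)
    (hpos : ∀ i, 0 < v i) : degree r a v ≤ 5 := by
  classical
  let S : Set (Set (Fin 3 → ℝ)) := {E | IsEdge r a E ∧ v ∈ E}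
  have hq : ∀ E, ∃ q, E ∈ S → EdgeAt r a v q E := fun E => by
    by_cases hE : E ∈ S
    · obtain ⟨q, hq⟩ := hE.1.exists_edgeAt har hv hpos hE.2
      exact ⟨q, fun _ => hq⟩
    · exact ⟨v, fun h => absurd h hE⟩
  choose q hq using hq
  let w : Set (Fin 3 → ℝ) → Fin 3 → ℝ := fun E => v + (1 / 2 : ℝ) • (q E - v)
  have h0 : (0 : ℝ) < 1 / 2 := by norm_num
  have h1 : (1 / 2 : ℝ) < 1 := by norm_num
  have hsum : ∀ E ∈ S, ∑ i, w E i = ∑ i, v i := fun E hE => by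
    rw [hv.sum_eq]; exact (hq E hE).sum_eq _
  have hsub : ∀ E ∈ S, minimizers r a (w E) ⊆ minimizers r a v := fun E hE =>
    (hq E hE).subset _ h0 h1
  have hl : ∀ E, ∃ l, E ∈ S → HasLabel r a v (w E) l := fun E => by
    by_cases hE : E ∈ S
    · obtain ⟨u, hu, u', hu', hne, hwt⟩ := (hq E hE).tie _ h0 h1
      obtain ⟨l, hl⟩ := exists_hasLabel har hpos ((hq E hE).pos _ h0 h1) (hsum E hE)
        (by simpa [w, sub_eq_zero] using (hq E hE).ne) (hsub E hE) hu hu' hne hwt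
      exact ⟨l, fun _ => hl⟩
    · exact ⟨(true, true, true), fun h => absurd h hE⟩
  choose l hl using hl
  have hinj : Set.InjOn l S := by
    intro E hE E' hE' h
    obtain ⟨c, hc, hcw⟩ := (hl E hE).exists_pos_smul har hpos (hsum E hE) (hsum E' hE')
      (hsub E hE) (hsub E' hE') (h ▸ hl E' hE')
    refine (hq E hE).eq_of_ray (hq E' hE') hc ?_
    simp only [w, add_sub_cancel_left] at hcw
    rw [smul_comm] at hcw
    exact smul_right_injective _ h0.ne' hcw
  have hcard : (l '' S).toFinset.card ≤ 5 := by
    refine card_labels_le _ (fun s p => ?_) fun s => ?_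
    · simp only [Set.mem_toFinset]
      rintro ⟨E, hE, e⟩ ⟨E', hE', e'⟩
      exact HasLabel.not_inner_of_axis har hpos (hsub E hE) (hsub E' hE')
        (e ▸ hl E hE) (e' ▸ hl E' hE')
    · simp only [Set.mem_toFinset]
      rintro ⟨E, hE, e⟩ ⟨E', hE', e'⟩
      exact HasLabel.not_axes hpos (hsub E hE) (hsub E' hE') (e ▸ hl E hE) (e' ▸ hl E' hE')
  change S.encard ≤ 5
  rw [← hinj.encard_image, Set.encard_eq_coe_toFinset_card]
  exact_mod_cast hcard

/-! ### Existence of edges near a vertex. -/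

theorem pairing_mono_left {v w : Fin 3 → ℝ} (h : ∀ i, v i ≤ w i) (u : Fin 3 →₀ ℕ) :
    pairing v u ≤ pairing w u :=
  Finset.sum_le_sum fun i _ => mul_le_mul_of_nonneg_right (h i) (Nat.cast_nonneg _)

theorem eventually_minimizers_subset {r a : ℕ} (hr : r ≠ 0) {v : Fin 3 → ℝ} (hv : ∀ i, 0 < v i)
    (η : Fin 3 → ℝ) : ∀ᶠ s in 𝓝[>] (0 : ℝ), (∀ i, 0 < (v + s • η) i) ∧
      minimizers r a (v + s • η) ⊆ minimizers r a v := by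
  choose ρ hρ hρ' using exists_minimizer (r := r) (a := a) hv
  have e1 := eventually_add_mul_pos (Set.toFinite (Set.univ : Set (Fin 3))) (fun i => v i / 2) η
    fun i _ => Or.inl (half_pos (hv i))
  have e2 := eventually_add_mul_pos (Set.toFinite ({0} : Set (Fin 3))) v (fun i => -η i)
    fun i _ => Or.inl (hv i)
  -- Near `v` coordinates are at least half those of `v` and the first at most doubles, so a
  -- least-weight monomial has `v`-weight at most `2 * (2 * v 0 * r)`. Only finitely many monomials
  -- remain to be excluded.
  have e3 := eventually_add_mul_pos
    ((finite_pairing_le hv (4 * (v 0 * r))).subset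
      (Set.sdiff_subset (t := minimizers r a v)))
    (fun u => pairing v u - pairing v (ρ u)) (fun u => pairing η u - pairing η (ρ u))
    fun u hu => by
      refine Or.inl (sub_pos.2 (lt_of_not_ge fun h => hu.2 ?_))
      exact mem_minimizers_of_pairing_le (hρ u) (hρ' u).symm h
  filter_upwards [e1, e2, e3] with s h1 h2 h3
  have h1' : ∀ i, v i / 2 ≤ (v + s • η) i := fun i => by
    have := h1 i (Set.mem_univ i)
    simp only [Pi.add_apply, Pi.smul_apply, smul_eq_mul]
    linarith
  have hpos : ∀ i, 0 < (v + s • η) i := fun i => (half_pos (hv i)).trans_le (h1' i)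
  refine ⟨hpos, fun u hu => ?_⟩
  by_contra hn
  have k1 := pairing_le_of_mem_minimizers hr (fun i => (hpos i).le) hu
  have k2 := pairing_mono_left (v := (1 / 2 : ℝ) • v) (w := v + s • η)
    (fun i => by have := h1' i; simp only [Pi.smul_apply, smul_eq_mul]; linarith) u
  rw [pairing_smul_left] at k2
  have k3 : (v + s • η) 0 * r ≤ 2 * v 0 * r := by
    refine mul_le_mul_of_nonneg_right ?_ r.cast_nonneg
    have := h2 0 rfl
    simp only [Pi.add_apply, Pi.smul_apply, smul_eq_mul]
    linarith
  have k4 := h3 u ⟨show pairing v u ≤ _ by linarith, hn⟩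
  have k5 := hu _ (hρ' u)
  simp only [pairing_add_left, pairing_smul_left] at k5
  linarith

/-- Rotating a direction `δ₁` towards `δ₀`, one meets a direction in which a tie survives. -/
theorem exists_wall {r a : ℕ} (hr : r ≠ 0) {v : Fin 3 → ℝ} (hv : ∀ i, 0 < v i)
    (δ₀ δ₁ : Fin 3 → ℝ) {x x' : Fin 3 →₀ ℕ} (hx : x ∈ minimizers r a v)
    (hx' : x' ∈ minimizers r a v) (hwt : wt r a x = wt r a x')
    (hne : pairing δ₀ x ≠ pairing δ₀ x') :
    ∃ t s : ℝ, 0 < s ∧ (∀ i, 0 < (v + s • (δ₁ + t • δ₀)) i) ∧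
      minimizers r a (v + s • (δ₁ + t • δ₀)) ⊆ minimizers r a v ∧
      ∃ u ∈ minimizers r a (v + s • (δ₁ + t • δ₀)),
        ∃ u' ∈ minimizers r a (v + s • (δ₁ + t • δ₀)), u ≠ u' ∧ wt r a u = wt r a u' := by
  let M : Set (Fin 3 →₀ ℕ) := {u | u ∈ minimizers r a v ∧ wt r a u = wt r a x}
  have hM : M.Finite := (finite_minimizers hr hv).subset fun _ h => h.1
  have hxM : x ∈ M := ⟨hx, rfl⟩
  have hxM' : x' ∈ M := ⟨hx', hwt.symm⟩
  obtain ⟨m, hm, hmin⟩ := Set.exists_min_image M (pairing δ₀) hM ⟨x, hxM⟩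
  obtain ⟨u, ⟨hu, hum⟩, hu'⟩ := Set.exists_min_image {u | u ∈ M ∧ pairing δ₀ u = pairing δ₀ m}
    (pairing δ₁) (hM.subset fun _ h => h.1) ⟨m, hm, rfl⟩
  have hBne : {z | z ∈ M ∧ pairing δ₀ u < pairing δ₀ z}.Nonempty := by
    by_contra hempty
    rw [Set.not_nonempty_iff_eq_empty] at hempty
    have hall : ∀ z ∈ M, pairing δ₀ z = pairing δ₀ u := fun z hz => by
      refine le_antisymm (not_lt.1 fun h => ?_) (hum ▸ hmin z hz)
      exact (Set.eq_empty_iff_forall_notMem.1 hempty z) ⟨hz, h⟩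
    exact hne ((hall x hxM).trans (hall x' hxM').symm)
  -- `u` is least for `δ₀`, with ties broken by `δ₁`. The largest ratio is the smallest `t` for
  -- which `u` is still least for `δ₁ + t • δ₀`, and there `z` draws level with it.
  obtain ⟨z, ⟨hz, huz⟩, hzmax⟩ := Set.exists_max_image _
    (fun z => (pairing δ₁ u - pairing δ₁ z) / (pairing δ₀ z - pairing δ₀ u))
    (hM.subset fun _ h => h.1) hBne
  set t := (pairing δ₁ u - pairing δ₁ z) / (pairing δ₀ z - pairing δ₀ u) with ht
  have htz : pairing (δ₁ + t • δ₀) z = pairing (δ₁ + t • δ₀) u := by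
    have := div_mul_cancel₀ (pairing δ₁ u - pairing δ₁ z) (sub_pos.2 huz).ne'
    rw [← ht] at this
    simp only [pairing_add_left, pairing_smul_left]
    linarith
  have htmin : ∀ y ∈ M, pairing (δ₁ + t • δ₀) u ≤ pairing (δ₁ + t • δ₀) y := by
    intro y hy
    simp only [pairing_add_left, pairing_smul_left]
    rcases (hum ▸ hmin y hy : pairing δ₀ u ≤ pairing δ₀ y).lt_or_eq with h | h
    · have := hzmax y ⟨hy, h⟩
      rw [div_le_iff₀ (sub_pos.2 h)] at this
      linarith
    · rw [← h]
      have := hu' y ⟨hy, h ▸ hum⟩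
      linarith
  obtain ⟨s, ⟨hpos, hsub⟩, hs⟩ :=
    ((eventually_minimizers_subset (a := a) hr hv (δ₁ + t • δ₀)).and self_mem_nhdsWithin).exists
  have hs : 0 < s := hs
  have hmem : ∀ y ∈ M, pairing (δ₁ + t • δ₀) y ≤ pairing (δ₁ + t • δ₀) u →
      y ∈ minimizers r a (v + s • (δ₁ + t • δ₀)) := by
    intro y hy hle
    obtain ⟨g, hg, hg'⟩ := exists_minimizer (r := r) (a := a) hpos y
    refine mem_minimizers_of_pairing_le hg hg'.symm ?_
    have h1 := mul_le_mul_of_nonneg_left (hle.trans (htmin g ⟨hsub hg, hg'.trans hy.2⟩)) hs.le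
    rw [pairing_add_left, pairing_add_left, pairing_smul_left, pairing_smul_left,
      pairing_eq_of_mem_minimizers hy.1 (hsub hg) hg'.symm]
    linarith
  exact ⟨t, s, hs, hpos, hsub, u, hmem u hu le_rfl, z, hmem z hz htz.le,
    fun h => huz.ne (by rw [h]), hu.2.trans hz.2.symm⟩

/-- Since `v` is orthogonal to `d` but not to `(1, 1, 1)`, these two vectors are independent and
their common orthogonal complement is a line. -/
theorem exists_smul_of_orthogonal {v x y : Fin 3 → ℝ} {d : Fin 3 → ℝ} (hv : ∑ i, v i ≠ 0)
    (hd : d ≠ 0) (hdv : ∑ i, v i * d i = 0) (hx : ∑ i, x i = 0) (hy : ∑ i, y i = 0) (hy0 : y ≠ 0)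
    (hdx : ∑ i, x i * d i = 0) (hdy : ∑ i, y i * d i = 0) : ∃ t : ℝ, x = t • y := by
  rw [Fin.sum_univ_three] at hv hdv hx hy hdx hdy
  have hcross : x 0 * y 1 = x 1 * y 0 := by
    by_contra hne
    have hne := sub_ne_zero.2 hne
    have e0 : d 0 - d 2 = 0 := by
      apply (mul_eq_zero.1 _).resolve_left hne
      linear_combination y 1 * hdx - x 1 * hdy - d 2 * (y 1 * hx - x 1 * hy)
    have e1 : d 1 - d 2 = 0 := by
      apply (mul_eq_zero.1 _).resolve_left hne
      linear_combination x 0 * hdy - y 0 * hdx - d 2 * (x 0 * hy - y 0 * hx)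
    have e2 : d 2 = 0 := by
      apply (mul_eq_zero.1 _).resolve_left hv
      linear_combination hdv - v 0 * e0 - v 1 * e1
    apply hd
    ext i
    fin_cases i <;> simp <;> linarith
  have hx2 : x 2 = -x 0 - x 1 := by linarith
  have hy2 : y 2 = -y 0 - y 1 := by linarith
  by_cases h0 : y 0 = 0
  · have h1 : y 1 ≠ 0 := by
      intro h1
      apply hy0
      ext i
      fin_cases i <;> simp [*]
    have hx0 : x 0 = 0 := by
      rw [h0, mul_zero] at hcross
      exact (mul_eq_zero.1 hcross).resolve_right h1
    refine ⟨x 1 / y 1, ?_⟩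
    ext i
    fin_cases i <;> simp [hx2, hy2, h0, hx0] <;> field_simp
  · refine ⟨x 0 / y 0, ?_⟩
    have : x 1 = x 0 / y 0 * y 1 := by field_simp; linarith
    ext i
    fin_cases i
    · simp; field_simp
    · simpa using this
    · simp only [Fin.reduceFinMk, Pi.smul_apply, smul_eq_mul]
      rw [hx2, hy2, this]; field_simp

/-- A point near the vertex `v` at which a tie survives lies on an edge through `v`. -/
theorem exists_isEdge {r a : ℕ} (har : a < r) {v w : Fin 3 → ℝ} (hv : ∀ i, 0 < v i)
    (hvs : ∑ i, v i = r) (hw : ∀ i, 0 < w i) (hws : ∑ i, w i = r) (hne : w ≠ v)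
    (hsub : minimizers r a w ⊆ minimizers r a v) {u u' : Fin 3 →₀ ℕ}
    (hu : u ∈ minimizers r a w) (hu' : u' ∈ minimizers r a w) (huu' : u ≠ u')
    (hwt : wt r a u = wt r a u') : ∃ E, IsEdge r a E ∧ v ∈ E ∧ w ∈ E := by
  have hr : r ≠ 0 := by omega
  obtain ⟨Γ, hΓ, hopen, hΓw⟩ := exists_isGGraph (a := a) hr hw
  choose ρ hρ hρ' using hΓ.exists_rep
  let F := (finite_minimizers (a := a) hr hw).toFinset
  -- A sum of forms nonnegative on the cone; it vanishes exactly where every least-weight monomial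
  -- of `w` stays level with its representative in `Γ`, which cuts out `τ`.
  let m : Fin 3 → ℝ := fun i => ∑ u ∈ F, ((u i : ℝ) - ρ u i)
  have hm : ∀ p : Fin 3 → ℝ, ∑ i, m i * p i = ∑ u ∈ F, (pairing p u - pairing p (ρ u)) := by
    intro p
    simp only [m, pairing, ← Finset.sum_sub_distrib, Finset.sum_mul]
    rw [Finset.sum_comm]
    refine Finset.sum_congr rfl fun u _ => Finset.sum_congr rfl fun i _ => by ring
  let τ : Set (Fin 3 → ℝ) := {p | minimizers r a w ⊆ minimizers r a p}
  have hnn : ∀ p ∈ closedCone r a Γ, ∀ u ∈ F, 0 ≤ pairing p u - pairing p (ρ u) :=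
    fun p hp u _ =>
      sub_nonneg.2 ((hΓ.mem_closedCone_iff har hopen).1 hp (hρ u) u (hρ' u).symm)
  have hτ : τ ∈ fan r a := by
    refine ⟨Γ, hΓ, hopen, m, fun p hp => ?_, ?_⟩
    · rw [hm]
      exact Finset.sum_nonneg (hnn p hp)
    · ext p
      refine ⟨fun hp => ⟨(hΓ.mem_closedCone_iff har hopen).2 (hΓw.trans hp), ?_⟩, ?_⟩
      · rw [hm]
        refine Finset.sum_eq_zero fun u hu => sub_eq_zero.2 ?_
        have hu : u ∈ minimizers r a w := by simpa [F] using hu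
        exact pairing_eq_of_mem_minimizers (hp hu) (hp (hΓw (hρ u))) (hρ' u).symm
      · rintro ⟨hp, h0⟩ u hu
        rw [hm] at h0
        have := (Finset.sum_eq_zero_iff_of_nonneg (hnn p hp)).1 h0 u (by simpa [F] using hu)
        exact mem_minimizers_of_pairing_le ((hΓ.mem_closedCone_iff har hopen).1 hp (hρ u))
          (hρ' u).symm (sub_eq_zero.1 this).le
  let E : Set (Fin 3 → ℝ) := τ ∩ {p | ∑ i, p i = (r : ℝ)}
  have hvE : v ∈ E := ⟨hsub, hvs⟩
  have hwE : w ∈ E := ⟨Set.Subset.rfl, hws⟩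
  have hEnn : ∀ p ∈ E, ∀ i, 0 ≤ p i := fun p hp =>
    hΓ.nonneg_of_mem_closedCone har hopen
      ((hΓ.mem_closedCone_iff har hopen).2 (hΓw.trans hp.1))
  have hEle : ∀ p ∈ E, ∀ i, p i ≤ r := fun p hp i => by
    rw [← (hp.2 : ∑ i, p i = (r : ℝ))]
    exact Finset.single_le_sum (fun i _ => hEnn p hp i) (Finset.mem_univ i)
  let f : ℝ →ᵃ[ℝ] (Fin 3 → ℝ) := AffineMap.lineMap v w
  have hf : ∀ t i, f t i = v i + t * (w i - v i) := by
    intro t i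
    simp [f, AffineMap.lineMap_apply]; ring
  have hline : ∀ p ∈ E, ∃ t, f t = p := by
    intro p hp
    have tie : ∀ p ∈ E, ∑ i, p i * ((u i : ℝ) - u' i) = 0 := by
      intro p hp
      have := pairing_eq_of_mem_minimizers (hp.1 hu) (hp.1 hu') hwt
      simp only [mul_sub, Finset.sum_sub_distrib]
      exact sub_eq_zero.2 this
    have hps : ∑ i, p i = (r : ℝ) := hp.2
    obtain ⟨t, ht⟩ := exists_smul_of_orthogonal (v := v) (x := p - v) (y := w - v)
      (d := fun i => (u i : ℝ) - u' i) (by rw [hvs]; exact_mod_cast hr)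
      (fun h => huu' (by
        ext i
        have := congrFun h i
        simp only [Pi.zero_apply, sub_eq_zero] at this
        exact_mod_cast this))
      (tie v hvE) (by simp [hvs, hps]) (by simp [hvs, hws])
      (sub_ne_zero.2 hne)
      (by simp only [Pi.sub_apply, sub_mul, Finset.sum_sub_distrib, tie p hp, tie v hvE, sub_zero])
      (by simp only [Pi.sub_apply, sub_mul, Finset.sum_sub_distrib, tie w hwE, tie v hvE,
        sub_zero])
    refine ⟨t, ?_⟩
    ext i
    have := congrFun ht i
    simp only [Pi.sub_apply, Pi.smul_apply, smul_eq_mul] at this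
    rw [hf]
    linarith
  -- The surviving tie confines `E` to the line through `v` and `w`; being closed, convex and
  -- bounded there, it is a segment.
  let T : Set ℝ := {t | f t ∈ E}
  have h0T : (0 : ℝ) ∈ T := by simpa [T, f] using hvE
  have h1T : (1 : ℝ) ∈ T := by simpa [T, f] using hwE
  have hpairf : ∀ t u, pairing (f t) u = pairing v u + t * (pairing w u - pairing v u) := by
    intro t u
    have : f t = v + t • (w - v) := by
      ext i; rw [hf]; simp
    rw [this, pairing_add_left, pairing_smul_left, pairing_sub_left]
  have hsumf : ∀ t, ∑ i, f t i = r := by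
    intro t
    simp only [hf, Finset.sum_add_distrib, ← Finset.mul_sum, Finset.sum_sub_distrib, hvs, hws]
    ring
  have hT : T = {t | ∀ u ∈ minimizers r a w, ∀ u', wt r a u' = wt r a u →
      pairing v u + t * (pairing w u - pairing v u) ≤
        pairing v u' + t * (pairing w u' - pairing v u')} := by
    ext t
    constructor
    · intro ht u hu u' h
      have := ht.1 hu u' h
      rwa [hpairf, hpairf] at this
    · intro ht
      refine ⟨fun u hu u' h => ?_, hsumf t⟩
      rw [hpairf, hpairf]
      exact ht u hu u' h
  have hclosed : IsClosed T := by
    rw [hT]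
    simp only [Set.ofPred_forall]
    refine isClosed_iInter fun u => isClosed_iInter fun _ => isClosed_iInter fun u' =>
      isClosed_iInter fun _ => isClosed_le (by fun_prop) (by fun_prop)
  have hconv : Convex ℝ T := by
    intro x hx y hy α β hα hβ hαβ
    rw [hT] at hx hy ⊢
    intro u hu u' h
    have h1 := mul_le_mul_of_nonneg_left (hx u hu u' h) hα
    have h2 := mul_le_mul_of_nonneg_left (hy u hu u' h) hβ
    obtain rfl : β = 1 - α := by linarith
    simp only [smul_eq_mul]
    linarith
  obtain ⟨i, hi⟩ := Function.ne_iff.1 hne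
  have hbdd : Bornology.IsBounded T := by
    refine (Metric.isBounded_closedBall (x := (0 : ℝ)) (r := r / |w i - v i|)).subset ?_
    intro t ht
    rw [Metric.mem_closedBall, dist_zero_right, Real.norm_eq_abs,
      le_div_iff₀ (abs_pos.2 (sub_ne_zero.2 hi)), ← abs_mul, abs_le]
    have h1 := hEnn _ ht i
    have h2 := hEle _ ht i
    have h3 := hEle _ hvE i
    have h4 := hv i
    rw [hf] at h1 h2
    constructor <;> linarith
  have hIcc := eq_Icc_of_connected_compact ⟨⟨0, h0T⟩, hconv.isPreconnected⟩
    (Metric.isCompact_of_isClosed_isBounded hclosed hbdd)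
  have hEimg : E = segment ℝ (f (sInf T)) (f (sSup T)) := by
    rw [hIcc] at h0T h1T
    rw [← image_segment, segment_eq_Icc (h0T.1.trans h0T.2), ← hIcc]
    ext p
    constructor
    · intro hp
      obtain ⟨t, rfl⟩ := hline p hp
      exact ⟨t, hp, rfl⟩
    · rintro ⟨t, ht, rfl⟩
      exact ht
  refine ⟨E, ⟨⟨τ, hτ, rfl⟩, _, _, fun h => ?_, hEimg⟩, hvE, hwE⟩
  rw [← h, segment_same] at hEimg
  exact hne ((hEimg ▸ hwE : w ∈ ({_} : Set _)).trans (hEimg ▸ hvE : v ∈ ({_} : Set _)).symm)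

/-! ### The lower bound. -/

/-- As the ties at `v` determine it, `δ₀` breaks one of them, and the rotation argument of
`exists_wall` applies. -/
theorem IsVertex.exists_isEdge {r a : ℕ} (har : a < r) {v : Fin 3 → ℝ} (hv : IsVertex r a v)
    (hpos : ∀ i, 0 < v i) {δ₀ δ₁ : Fin 3 → ℝ} (h0 : ∑ i, δ₀ i = 0) (h1 : ∑ i, δ₁ i = 0)
    (hδ₀ : δ₀ ≠ 0) (hδ : ∀ t : ℝ, δ₁ + t • δ₀ ≠ 0) :
    ∃ E t s, 0 < s ∧ IsEdge r a E ∧ v ∈ E ∧ v + (s : ℝ) • (δ₁ + (t : ℝ) • δ₀) ∈ E := by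
  obtain ⟨x, hx, x', hx', hwt, hne⟩ : ∃ x ∈ minimizers r a v, ∃ x' ∈ minimizers r a v,
      wt r a x = wt r a x' ∧ pairing δ₀ x ≠ pairing δ₀ x' := by
    by_contra hno
    push Not at hno
    exact hδ₀ (hv.eq_zero_of_ties har h0 hno)
  obtain ⟨t, s, hs, hw, hsub, u, hu, u', hu', huu', hwt'⟩ :=
    exists_wall (by omega) hpos δ₀ δ₁ hx hx' hwt hne
  obtain ⟨E, hE, hvE, hwE⟩ := GHilb.exists_isEdge har hpos hv.sum_eq hw
    (by simp [Finset.sum_add_distrib, ← Finset.mul_sum, h0, h1, hv.sum_eq])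
    (fun h => hδ t ((smul_eq_zero.1 (add_eq_left.1 h)).resolve_left hs.ne')) hsub hu hu' huu' hwt'
  exact ⟨E, t, s, hs, hE, hvE, hwE⟩

/-- Turning a transversal direction towards the first edge never crosses its line, so an edge arises
strictly on either side. -/
theorem three_le_degree {r a : ℕ} (har : a < r) {v : Fin 3 → ℝ} (hv : IsVertex r a v)
    (hpos : ∀ i, 0 < v i) : 3 ≤ degree r a v := by
  obtain ⟨E₁, -, -, -, hE₁, hv₁, -⟩ := hv.exists_isEdge har hpos (δ₀ := ![1, -1, 0])
    (δ₁ := ![0, 1, -1]) (by simp [Fin.sum_univ_three]) (by simp [Fin.sum_univ_three])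
    (fun h => by simpa using congrFun h 0) (fun t h => by simpa using congrFun h 2)
  obtain ⟨q, hq⟩ := hE₁.exists_edgeAt har hv hpos hv₁
  set δ := q - v with hδ
  have hδ0 : δ ≠ 0 := sub_ne_zero.2 hq.ne
  have hδs : ∑ i, δ i = 0 := by
    have h := hq.sum_eq 1
    rw [one_smul, add_sub_cancel] at h
    simp [hδ, h, hv.sum_eq]
  -- the linear form that vanishes on the direction of the first edge
  let form : (Fin 3 → ℝ) → ℝ := fun p => δ 0 * p 1 - δ 1 * p 0
  have hform : ∀ (c : ℝ) p, form (c • p) = c * form p := fun c p => by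
    simp only [form, Pi.smul_apply, smul_eq_mul]; ring
  have hform₁ : ∀ p ∈ E₁, form (p - v) = 0 := by
    intro p hp
    rw [hq.eq_segment, segment_eq_image'] at hp
    obtain ⟨t, -, rfl⟩ := hp
    rw [add_sub_cancel_left, hform]
    simp only [form, ← hδ]
    ring
  have hside : ∀ σ : ℝ, σ ≠ 0 → ∃ E, IsEdge r a E ∧ v ∈ E ∧ (∀ p ∈ E, 0 ≤ σ * form (p - v)) ∧
      ∃ p ∈ E, 0 < σ * form (p - v) := by
    intro σ hσ
    have hsq : 0 < δ 0 ^ 2 + δ 1 ^ 2 := by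
      by_contra hle
      have h0 : δ 0 = 0 := by nlinarith [sq_nonneg (δ 0), sq_nonneg (δ 1)]
      have h1 : δ 1 = 0 := by nlinarith [sq_nonneg (δ 0), sq_nonneg (δ 1)]
      rw [Fin.sum_univ_three, h0, h1] at hδs
      apply hδ0
      ext i
      fin_cases i <;> simp <;> linarith
    -- The first two coordinates are those of `δ` turned by a right angle and scaled by `σ`; the
    -- third makes the sum zero.
    let ν : Fin 3 → ℝ := ![-(σ * δ 1), σ * δ 0, σ * (δ 1 - δ 0)]
    have hν : ∀ t : ℝ, form (ν + t • δ) = σ * (δ 0 ^ 2 + δ 1 ^ 2) := by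
      intro t
      simp only [form, ν, Pi.add_apply, Pi.smul_apply, smul_eq_mul, Matrix.cons_val_zero,
        Matrix.cons_val_one]
      ring
    have hσ2 : 0 < σ * σ := mul_self_pos.2 hσ
    obtain ⟨E, t, s, hs, hE, hvE, hwE⟩ := hv.exists_isEdge har hpos (δ₀ := δ) (δ₁ := ν) hδs
      (by simp [ν, Fin.sum_univ_three]; ring) hδ0 (fun t h => by
        have := hν t
        rw [h] at this
        simp [form] at this
        rcases this with h | h
        · exact hσ h
        · exact hsq.ne' h)
    have hw : 0 < σ * form (v + s • (ν + t • δ) - v) := by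
      rw [add_sub_cancel_left, hform, hν]
      calc 0 < s * (σ * σ) * (δ 0 ^ 2 + δ 1 ^ 2) := by positivity
        _ = _ := by ring
    refine ⟨E, hE, hvE, fun p hp => ?_, _, hwE, hw⟩
    obtain ⟨q', hq'⟩ := hE.exists_edgeAt har hv hpos hvE
    have hseg := hq'.eq_segment
    rw [segment_eq_image'] at hseg
    rw [hseg] at hp hwE
    obtain ⟨x, hx, rfl⟩ := hp
    obtain ⟨y, hy, hyw⟩ := hwE
    simp only at hyw
    rw [← hyw, add_sub_cancel_left, hform] at hw
    rw [add_sub_cancel_left, hform]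
    have hpos' : 0 < σ * form (q' - v) := by
      refine pos_of_mul_pos_right (a := y) ?_ hy.1
      linarith
    have := mul_nonneg hx.1 hpos'.le
    linarith
  obtain ⟨E₂, hE₂, hv₂, hn₂, p₂, hp₂, hf₂⟩ := hside 1 one_ne_zero
  obtain ⟨E₃, hE₃, hv₃, -, p₃, hp₃, hf₃⟩ := hside (-1) (by norm_num)
  have h12 : E₁ ≠ E₂ := by
    rintro rfl
    rw [hform₁ _ hp₂] at hf₂
    simp at hf₂
  have h13 : E₁ ≠ E₃ := by
    rintro rfl
    rw [hform₁ _ hp₃] at hf₃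
    simp at hf₃
  have h23 : E₂ ≠ E₃ := by
    rintro rfl
    have := hn₂ _ hp₃
    linarith
  have hcard : ({E₁, E₂, E₃} : Set (Set (Fin 3 → ℝ))).encard = 3 :=
    Set.encard_eq_three.2 ⟨E₁, E₂, E₃, h12, h13, h23, rfl⟩
  rw [← hcard]
  refine Set.encard_le_encard ?_
  rintro E (rfl | rfl | rfl)
  exacts [⟨hE₁, hv₁⟩, ⟨hE₂, hv₂⟩, ⟨hE₃, hv₃⟩]

end GHilb

theorem lemma2 (r a : ℕ) (ha : 0 < a) (har : a < r) (hra : Nat.Coprime r a)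
    (v : Fin 3 → ℝ) (hv : GHilb.IsVertex r a v)
    (hne : ∀ i : Fin 3, v ≠ Pi.single i (r : ℝ)) :
    3 ≤ GHilb.degree r a v ∧ GHilb.degree r a v ≤ 5 := by
  have hpos := hv.pos ha har hra hne
  exact ⟨GHilb.three_le_degree har hv hpos, GHilb.degree_le_five har hv hpos⟩
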